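/- Let $E$ be a complex Banach space, let $M\ge 1$, and let $\{T(t)\}_{t\ge 0}$ be a $C_0$-semigroup of bounded linear operators on $E$ (that is, $T(0)=I$, $T(t+s)=T(t)T(s)$ for $t,s\ge0$, and $\lim_{t\searrow 0}T(t)x=x$ for all $x\in E$) with $\|T(t)\|\le M$ for all $t\ge 0$. Let $A$ be its infinitesimal generator, $Ax=\lim_{h\searrow 0}\frac{T(h)x-x}{h}$ on the domain $D(A)$ of all $x\in E$ for which the limit exists. Let $\rho(A)$ be the set of all $\lambda\in\mathbb C$ for which $\lambda I-A:D(A)\to E$ is bijective, put $R(\lambda;A)=(\lambda I-A)^{-1}$ for $\lambda\in\rho(A)$, and suppose that $0\in\rho(A)$. Then the following statements are equivalent. (i) There is $\delta>0$ such that $\{T(t)\}_{t\ge 0}$ extends to an analytic semigroup $\{T(z)\}$ in the sector $\Delta_\delta=\{z\in\mathbb C: \operatorname{Re} z>0,\ |\arg z|<\delta\}$ (that is, $T(0)=I$, $T(z_1+z_2)=T(z_1)T(z_2)$ for $z_1,z_2\in\Delta_\delta$, $\lim_{z\to 0,\,z\in\Delta_\delta}T(z)x=x$ for all $x\in E$,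 and $z\mapsto T(z)\in\mathcal B(E)$ is analytic on $\Delta_\delta$), and for each $\delta'\in(0,\delta)$ the family $T(z)$ is uniformly bounded on the closed subsector $\{z: \operatorname{Re} z>0,\ |\arg z|\le\delta'\}$. (ii) There is a constant $C>0$ such that for all real $\gamma>0$ and $\eta\ne 0$ one has $\gamma+i\eta\in\rho(A)$ and $\|R(\gamma+i\eta;A)\|\le \dfrac{C}{|\eta|}$. (iii) There are $\delta\in(0,\frac{\pi}{2})$ and $K>1$ such that $\Sigma_\delta=\{\lambda\in\mathbb C\setminus\{0\}: |\arg\lambda|<\frac{\pi}{2}+\delta\}\cup\{0\}\subset\rho(A)$ and $\|R(\lambda;A)\|\le\dfrac{K}{|\lambda|}$ for all $\lambda\in\Sigma_\delta\setminus\{0\}$. (iv) The map $(0,\infty)\ni t\mapsto T(t)\in\mathcal B(E)$ is differentiable in operator norm, and there is a constant $L>0$ such that for all $t>0$ one has $T(t)E\subset D(A)$, $AT(t)\in\mathcal B(E)$ and $\|AT(t)\|\le\dfrac{L}{t}$. -/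

import Mathlib

open Filter Topology

namespace SemigroupTheory

section

variable {E : Type*} [NormedAddCommGroup E] [NormedSpace ℂ E]

/-- `T` restricted to `[0, ∞)` is a C₀-semigroup of bounded operators on `E`
(the values of `T` at negative times play no role anywhere). -/
structure IsC0Semigroup (T : ℝ → E →L[ℂ] E) : Prop where
  map_zero : T 0 = ContinuousLinearMap.id ℂ E
  map_add : ∀ s t : ℝ, 0 ≤ s → 0 ≤ t → T (s + t) = (T s).comp (T t)
  tendsto_zero : ∀ x : E, Tendsto (fun t : ℝ => T t x) (𝓝[>] 0) (𝓝 x)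

/-- The class of C₀-semigroups with `‖T t‖ ≤ M e^{ω t}` for all `t ≥ 0`. -/
structure IsSG (M ω : ℝ) (T : ℝ → E →L[ℂ] E) : Prop where
  isC0Semigroup : IsC0Semigroup T
  bound : ∀ t : ℝ, 0 ≤ t → ‖T t‖ ≤ M * Real.exp (ω * t)

/-- The difference quotient `(T(h)x - x)/h`. -/
noncomputable def diffQuot (T : ℝ → E →L[ℂ] E) (x : E) (h : ℝ) : E :=
  ((h : ℂ)⁻¹) • (T h x - x)

theorem diffQuot_tendsto_add {T : ℝ → E →L[ℂ] E} {x x' y y' : E}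
    (h : Tendsto (diffQuot T x) (𝓝[>] 0) (𝓝 y)) (h' : Tendsto (diffQuot T x') (𝓝[>] 0) (𝓝 y')) :
    Tendsto (diffQuot T (x + x')) (𝓝[>] 0) (𝓝 (y + y')) := by
  refine (h.add h').congr fun t => ?_
  simp only [diffQuot, map_add, ← smul_add]
  congr 1
  abel

theorem diffQuot_tendsto_smul {T : ℝ → E →L[ℂ] E} {x y : E} (c : ℂ)
    (h : Tendsto (diffQuot T x) (𝓝[>] 0) (𝓝 y)) :
    Tendsto (diffQuot T (c • x)) (𝓝[>] 0) (𝓝 (c • y)) := by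
  refine (h.const_smul c).congr fun t => ?_
  simp only [diffQuot, map_smul, ← smul_sub]
  rw [smul_comm]

/-- The domain of the infinitesimal generator: all `x` for which
`lim_{h ↘ 0} (T(h)x - x)/h` exists. -/
def generatorDomain (T : ℝ → E →L[ℂ] E) : Submodule ℂ E where
  carrier := {x | ∃ y : E, Tendsto (diffQuot T x) (𝓝[>] 0) (𝓝 y)}
  add_mem' := fun ⟨_, h⟩ ⟨_, h'⟩ => ⟨_, diffQuot_tendsto_add h h'⟩
  zero_mem' := ⟨0, (tendsto_const_nhds (x := (0 : E))).congr fun h => by simp [diffQuot]⟩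
  smul_mem' := fun c _ ⟨_, h⟩ => ⟨_, diffQuot_tendsto_smul c h⟩

/-- The infinitesimal generator `A x = lim_{h ↘ 0} (T(h)x - x)/h`, an (in general unbounded)
operator with domain `generatorDomain T`. -/
noncomputable def generator (T : ℝ → E →L[ℂ] E) : E →ₗ.[ℂ] E where
  domain := generatorDomain T
  toFun :=
    { toFun := fun x => x.2.choose
      map_add' := fun x y => tendsto_nhds_unique (x + y).2.choose_spec
        (diffQuot_tendsto_add x.2.choose_spec y.2.choose_spec)
      map_smul' := fun c x => tendsto_nhds_unique (c • x).2.choose_spec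
        (diffQuot_tendsto_smul c x.2.choose_spec) }

theorem generator_tendsto (T : ℝ → E →L[ℂ] E) (x : (generator T).domain) :
    Tendsto (diffQuot T (x : E)) (𝓝[>] 0) (𝓝 (generator T x)) :=
  x.2.choose_spec

/-- The resolvent set of `A`: all `μ` such that `μ I - A : D(A) → E` is bijective. -/
def resolventSet (A : E →ₗ.[ℂ] E) : Set ℂ :=
  {μ | Function.Bijective fun x : A.domain => μ • (x : E) - A x}

/-- `R` is a bounded two-sided inverse of `μ I - A : D(A) → E`. -/
structure IsResolventAt (A : E →ₗ.[ℂ] E) (μ : ℂ) (R : E →L[ℂ] E) : Prop where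
  right_inv : ∀ y : E, ∃ h : R y ∈ A.domain, μ • R y - A ⟨R y, h⟩ = y
  left_inv : ∀ x : A.domain, R (μ • (x : E) - A x) = x

open Classical in
/-- The resolvent `R(μ; A) = (μ I - A)⁻¹`, as a bounded operator on `E`. For closed `A`
it is the inverse of `μ I - A` at every point of the resolvent set, see `isResolventAt_resolvent`
(the value `0` where there is no bounded inverse is a convention). -/
noncomputable def resolvent (A : E →ₗ.[ℂ] E) (μ : ℂ) : E →L[ℂ] E :=
  if h : ∃ R : E →L[ℂ] E, IsResolventAt A μ R then h.choose else 0

theorem IsResolventAt.resolvent_eq {A : E →ₗ.[ℂ] E} {μ : ℂ} {R : E →L[ℂ] E}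
    (hR : IsResolventAt A μ R) : resolvent A μ = R := by
  have h : ∃ R : E →L[ℂ] E, IsResolventAt A μ R := ⟨R, hR⟩
  rw [resolvent, dif_pos h]
  ext y
  obtain ⟨hy, e⟩ := hR.right_inv y
  have := h.choose_spec.left_inv ⟨R y, hy⟩
  rwa [e] at this

theorem isResolventAt_resolvent [CompleteSpace E] {A : E →ₗ.[ℂ] E} (hA : A.IsClosed) {μ : ℂ}
    (hμ : μ ∈ resolventSet A) : IsResolventAt A μ (resolvent A μ) := by
  suffices h : ∃ R : E →L[ℂ] E, IsResolventAt A μ R by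
    rw [resolvent, dif_pos h]
    exact h.choose_spec
  let f : A.domain →ₗ[ℂ] E := μ • A.domain.subtype - A.toFun
  have hf : Function.Bijective f := hμ
  let e := LinearEquiv.ofBijective f hf
  let g : E →ₗ[ℂ] E := A.domain.subtype ∘ₗ e.symm.toLinearMap
  have he : ∀ y : E, μ • g y - A (e.symm y) = y := fun y => e.apply_symm_apply y
  have hg : IsClosed (g.graph : Set (E × E)) := by
    have h2 : (g.graph : Set (E × E)) =
        (fun p : E × E => (p.2, μ • p.2 - p.1)) ⁻¹' (A.graph : Set (E × E)) := by
      ext ⟨y, x⟩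
      simp only [SetLike.mem_coe, LinearMap.mem_graph_iff, Set.mem_preimage,
        LinearPMap.mem_graph_iff]
      constructor
      · rintro rfl
        exact ⟨e.symm y, rfl, by rw [eq_sub_iff_add_eq, ← eq_sub_iff_add_eq', he]⟩
      · rintro ⟨z, hz, hz'⟩
        have h3 : e z = y := by
          change μ • (z : E) - A z = y
          rw [hz, hz']; abel
        rw [← h3, ← hz]
        simp [g]
    rw [h2]
    exact hA.preimage (by fun_prop)
  refine ⟨ContinuousLinearMap.ofIsClosedGraph hg, fun y => ⟨(e.symm y).2, he y⟩, fun x => ?_⟩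
  have : e.symm (e x) = x := e.symm_apply_apply x
  exact congrArg Subtype.val this

/-- The open sector `{z | Re z > 0, |arg z| < δ}`. -/
def sector (δ : ℝ) : Set ℂ := {z | 0 < z.re ∧ |z.arg| < δ}

/-- The closed subsector `{z | Re z > 0, |arg z| ≤ δ}`. -/
def closedSector (δ : ℝ) : Set ℂ := {z | 0 < z.re ∧ |z.arg| ≤ δ}

/-- `S` is an analytic C₀-semigroup on `Δ ∪ {0}`, where `Δ` is an open sector around
the positive half-line (the values of `S` elsewhere play no role). -/
structure IsAnalyticSemigroup (Δ : Set ℂ) (S : ℂ → E →L[ℂ] E) : Prop where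
  map_zero : S 0 = ContinuousLinearMap.id ℂ E
  map_add : ∀ z ∈ Δ, ∀ w ∈ Δ, S (z + w) = (S z).comp (S w)
  tendsto_zero : ∀ x : E, Tendsto (fun z : ℂ => S z x) (𝓝[Δ] 0) (𝓝 x)
  analytic : AnalyticOnNhd ℂ S Δ

/-- The set `{μ ≠ 0 | |arg μ| < π/2 + δ} ∪ {0}`. -/
def resolventSector (δ : ℝ) : Set ℂ := {μ | μ ≠ 0 ∧ |μ.arg| < Real.pi / 2 + δ} ∪ {0}

end

end SemigroupTheory

namespace SemigroupTheory

open MeasureTheory Set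

/-! ### Semigroup orbits, the generator and the resolvent identity -/

section Basics

variable {E : Type*} [NormedAddCommGroup E] [NormedSpace ℂ E]

/-! The bound on `A T(t)` in (iv) is the hub: it is shown equivalent to (i) and to (ii), and (ii) to
(iii).

(i) → (iv) is Cauchy's estimate: the disc about `t` of radius `c t` lies in a closed subsector, so
`T'(t) = A T(t)` is `O(1/t)` (`IsAnalyticSemigroup.exists_deriv_bound`).

(iv) → (i) sums the Taylor series. Splitting `t` into `n + 1` equal times gives `A^n T(t) = (A
T(t/(n+1)))^n T(t/(n+1))`, hence `‖A^n T(t)‖ ≤ M ((n+1) L / t)^n`; since `(n+1)^n / n! ≤ e^(n+1)`,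
the series at `a > 0` converges geometrically for `|z - a| ≤ a / (2 e L)`. These discs sweep out a
sector. The sum is independent of the centre (`tsum_taylorTerm_eq`), so it is holomorphic, and the
semigroup law follows from the identity theorem (`taylorExt_add`).

(iv) → (ii): in `R(μ) = ∫ e^(-μt) T(t) dt` the part over `t ≤ 1/|Im μ|` is trivially `O(1/|Im μ|)`;
on the rest, two integrations by parts replace `T(t)` by `μ^(-2) A² T(t)`, of size `|μ|^(-2)
t^(-2)`, with boundary terms of the right order (`IsGeneratorComp.norm_resolvent_le`).

(ii) → (iv): with the Hille–Yosida bound `M / Re μ`, (ii) gives `‖R(μ)‖ ≤ K/|μ|` on the right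
half-plane. Inverting the Laplace transform of `t² T(t)`, which is `2 R(μ)³`, on the line `Re μ =
1/t` gives an absolutely convergent integral that survives an application of `A`, because `A R³ = μ
R³ - R²` is still `O(|μ|^(-2))` (`IsSG.generator_apply_norm_le`).

(ii) → (iii) is a Neumann series across the imaginary axis (`exists_sector_bound`); (iii) → (ii) is
`|Im μ| ≤ |μ|`. -/

theorem generator_eq_of_tendsto {T : ℝ → E →L[ℂ] E} {x y : E}
    (h : Tendsto (diffQuot T x) (𝓝[>] 0) (𝓝 y)) :
    ∃ hx : x ∈ (generator T).domain, generator T ⟨x, hx⟩ = y :=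
  ⟨⟨y, h⟩, tendsto_nhds_unique (generator_tendsto T ⟨x, ⟨y, h⟩⟩) h⟩

theorem IsC0Semigroup.map_add_apply {T : ℝ → E →L[ℂ] E} (hT : IsC0Semigroup T) {s t : ℝ}
    (hs : 0 ≤ s) (ht : 0 ≤ t) (x : E) : T (s + t) x = T s (T t x) := by
  rw [hT.map_add s t hs ht]; rfl

theorem IsC0Semigroup.comm_apply {T : ℝ → E →L[ℂ] E} (hT : IsC0Semigroup T) {s t : ℝ}
    (hs : 0 ≤ s) (ht : 0 ≤ t) (x : E) : T s (T t x) = T t (T s x) := by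
  rw [← hT.map_add_apply hs ht, ← hT.map_add_apply ht hs, add_comm]

theorem IsC0Semigroup.generator_apply {T : ℝ → E →L[ℂ] E} (hT : IsC0Semigroup T) {t : ℝ}
    (ht : 0 ≤ t) (x : (generator T).domain) :
    ∃ h : T t x ∈ (generator T).domain, generator T ⟨T t x, h⟩ = T t (generator T x) := by
  apply generator_eq_of_tendsto
  refine ((T t).continuous.tendsto _ |>.comp (generator_tendsto T x)).congr' ?_
  filter_upwards [self_mem_nhdsWithin] with h hh
  simp only [Function.comp, diffQuot, map_smul, map_sub]
  rw [hT.comm_apply ht (le_of_lt hh)]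

theorem IsSG.norm_le {M : ℝ} {T : ℝ → E →L[ℂ] E} (hT : IsSG M 0 T) {t : ℝ} (ht : 0 ≤ t) :
    ‖T t‖ ≤ M := by
  simpa using hT.bound t ht

theorem IsSG.nonneg {M : ℝ} {T : ℝ → E →L[ℂ] E} (hT : IsSG M 0 T) : 0 ≤ M :=
  (norm_nonneg _).trans (hT.norm_le le_rfl)

theorem IsSG.norm_apply_le {M : ℝ} {T : ℝ → E →L[ℂ] E} (hT : IsSG M 0 T) {t : ℝ} (ht : 0 ≤ t)
    (x : E) : ‖T t x‖ ≤ M * ‖x‖ :=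
  (T t).le_of_opNorm_le (hT.norm_le ht) x

/-- Factor out `T` at the smaller time. Both one-sided cases then reduce to continuity at `0`. -/
theorem IsSG.norm_sub_le {M : ℝ} {T : ℝ → E →L[ℂ] E} (hT : IsSG M 0 T) {s t : ℝ}
    (hs : 0 ≤ s) (ht : 0 ≤ t) (x : E) : ‖T s x - T t x‖ ≤ M * ‖T |s - t| x - x‖ := by
  wlog h : t ≤ s generalizing s t
  · rw [norm_sub_rev, abs_sub_comm]
    exact this ht hs (le_of_not_ge h)
  rw [abs_of_nonneg (sub_nonneg.2 h)]
  have : T s x = T t (T (s - t) x) := by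
    rw [← hT.isC0Semigroup.map_add_apply ht (sub_nonneg.2 h)]; congr 2; ring
  rw [this, ← map_sub]
  exact hT.norm_apply_le ht _

theorem IsC0Semigroup.tendsto_abs {T : ℝ → E →L[ℂ] E} (hT : IsC0Semigroup T) (x : E) :
    Tendsto (fun h : ℝ => T |h| x) (𝓝 0) (𝓝 x) := by
  have h1 : ContinuousWithinAt (fun h : ℝ => T h x) (Ici 0) 0 := by
    rw [← continuousWithinAt_Ioi_iff_Ici]
    simpa [ContinuousWithinAt, hT.map_zero] using hT.tendsto_zero x
  have h2 : Tendsto (fun h : ℝ => |h|) (𝓝 0) (𝓝[≥] 0) :=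
    tendsto_nhdsWithin_iff.2 ⟨by simpa using (continuous_abs.tendsto (0 : ℝ)),
      Eventually.of_forall fun h => abs_nonneg h⟩
  simpa [Function.comp_def, hT.map_zero] using h1.tendsto.comp h2

theorem IsSG.continuousOn {M : ℝ} {T : ℝ → E →L[ℂ] E} (hT : IsSG M 0 T) (x : E) :
    ContinuousOn (fun t => T t x) (Ici 0) := by
  intro t ht
  rw [ContinuousWithinAt, tendsto_iff_norm_sub_tendsto_zero]
  have h2 : Tendsto (fun s : ℝ => s - t) (𝓝[Ici 0] t) (𝓝 0) := by
    have : Tendsto (fun s : ℝ => s - t) (𝓝 t) (𝓝 0) := by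
      simpa using (continuous_sub_right t).tendsto t
    exact this.mono_left nhdsWithin_le_nhds
  have h3 := (hT.isC0Semigroup.tendsto_abs x).comp h2
  have h4 : Tendsto (fun s : ℝ => M * ‖T |s - t| x - x‖) (𝓝[Ici 0] t) (𝓝 0) := by
    simpa using ((h3.sub_const x).norm).const_mul M
  refine tendsto_of_tendsto_of_tendsto_of_le_of_le' tendsto_const_nhds h4
    (Eventually.of_forall fun _ => norm_nonneg _) ?_
  filter_upwards [self_mem_nhdsWithin] with s hs
  exact hT.norm_sub_le hs ht x

/-- The generator only supplies a right derivative at `0`. Left and right slopes at `t` both equal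
`T(min s t)` applied to the difference quotient of step `|s - t|`; uniform boundedness and strong
continuity let both factors pass to the limit. -/
theorem IsSG.hasDerivAt {M : ℝ} {T : ℝ → E →L[ℂ] E} (hT : IsSG M 0 T)
    (x : (generator T).domain) {t : ℝ} (ht : 0 < t) :
    HasDerivAt (fun s => T s (x : E)) (T t (generator T x)) t := by
  rw [hasDerivAt_iff_tendsto_slope]
  set y := generator T x
  have habs : Tendsto (fun s : ℝ => |s - t|) (𝓝[≠] t) (𝓝[>] 0) := by
    refine tendsto_nhdsWithin_iff.2 ⟨?_, ?_⟩
    · have : Tendsto (fun s : ℝ => |s - t|) (𝓝 t) (𝓝 0) := by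
        simpa using ((continuous_sub_right t).abs).tendsto t
      exact this.mono_left nhdsWithin_le_nhds
    · filter_upwards [self_mem_nhdsWithin] with s hs
      exact abs_pos.2 (sub_ne_zero.2 hs)
  have h1 := (generator_tendsto T x).comp habs
  have hmin : Tendsto (fun s : ℝ => min s t) (𝓝[≠] t) (𝓝[Ici 0] t) := by
    refine tendsto_nhdsWithin_iff.2 ⟨?_, ?_⟩
    · have : Tendsto (fun s : ℝ => min s t) (𝓝 t) (𝓝 t) := by
        simpa using ((continuous_id.min continuous_const).tendsto t : Tendsto
          (fun s : ℝ => min s t) _ _)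
      exact this.mono_left nhdsWithin_le_nhds
    · filter_upwards [nhdsWithin_le_nhds (lt_mem_nhds ht)] with s hs
      exact (lt_min hs ht).le
  have h2 := (hT.continuousOn y t ht.le).tendsto.comp hmin
  have h3 : Tendsto (fun s : ℝ => T (min s t) (diffQuot T x |s - t|)) (𝓝[≠] t) (𝓝 (T t y)) := by
    have h4 : Tendsto (fun s : ℝ => T (min s t) (diffQuot T x |s - t|) - T (min s t) y)
        (𝓝[≠] t) (𝓝 0) := by
      rw [tendsto_zero_iff_norm_tendsto_zero]
      have h5 : Tendsto (fun s : ℝ => M * ‖diffQuot T x |s - t| - y‖) (𝓝[≠] t) (𝓝 0) := by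
        simpa [y] using ((h1.sub_const y).norm).const_mul M
      refine tendsto_of_tendsto_of_tendsto_of_le_of_le' tendsto_const_nhds h5
        (Eventually.of_forall fun _ => norm_nonneg _) ?_
      filter_upwards [nhdsWithin_le_nhds (lt_mem_nhds ht)] with s hs
      rw [← map_sub]
      exact hT.norm_apply_le (lt_min hs ht).le _
    simpa using h4.add h2
  refine h3.congr' ?_
  filter_upwards [self_mem_nhdsWithin, nhdsWithin_le_nhds (lt_mem_nhds ht)] with s hs hs0
  have hadd : T (min s t) (T |s - t| x) = T (max s t) x := by
    rw [← hT.isC0Semigroup.map_add_apply (lt_min hs0 ht).le (abs_nonneg _)]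
    congr 2
    rw [← max_sub_min_eq_abs']; ring
  rw [diffQuot, map_smul, map_sub, hadd, slope_def_module]
  rcases lt_or_gt_of_ne hs with h | h
  · rw [min_eq_left h.le, max_eq_right h.le, abs_of_neg (sub_neg.2 h), ← neg_sub (T s (x : E)),
      smul_neg, ← neg_smul, Complex.ofReal_neg, inv_neg, neg_neg, ← Complex.ofReal_inv,
      Complex.coe_smul]
  · rw [min_eq_right h.le, max_eq_left h.le, abs_of_pos (sub_pos.2 h), ← Complex.ofReal_inv,
      Complex.coe_smul]

theorem IsResolventAt.mem_resolventSet {A : E →ₗ.[ℂ] E} {μ : ℂ} {R : E →L[ℂ] E}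
    (hR : IsResolventAt A μ R) : μ ∈ resolventSet A := by
  constructor
  · intro x y h
    have h' : R (μ • (x : E) - A x) = R (μ • (y : E) - A y) := congrArg R h
    rw [hR.left_inv, hR.left_inv] at h'
    exact Subtype.ext h'
  · intro y
    obtain ⟨h, e⟩ := hR.right_inv y
    exact ⟨⟨R y, h⟩, e⟩

/-- The graph is cut out by the closed condition `R(μx - y) = x`. One resolvent point thus gives the
closedness that `isResolventAt_resolvent` needs at `0`. -/
theorem IsResolventAt.isClosed {A : E →ₗ.[ℂ] E} {μ : ℂ} {R : E →L[ℂ] E}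
    (hR : IsResolventAt A μ R) : A.IsClosed := by
  have h : (A.graph : Set (E × E)) = {p | R (μ • p.1 - p.2) = p.1} := by
    ext ⟨x, y⟩
    simp only [SetLike.mem_coe, LinearPMap.mem_graph_iff, mem_ofPred_eq]
    constructor
    · rintro ⟨z, hz, hz'⟩
      rw [← hz, ← hz', hR.left_inv]
    · intro h
      obtain ⟨h1, e⟩ := hR.right_inv (μ • x - y)
      refine ⟨⟨_, h1⟩, h, ?_⟩
      have e' : μ • x - A ⟨R (μ • x - y), h1⟩ = μ • x - y := by
        simpa only [h] using e
      exact sub_right_injective e'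
  rw [LinearPMap.IsClosed, h]
  exact isClosed_eq (by fun_prop) (by fun_prop)

/-- The resolvent identity. -/
theorem IsResolventAt.sub_eq {A : E →ₗ.[ℂ] E} {μ ν : ℂ} {R S : E →L[ℂ] E}
    (hR : IsResolventAt A μ R) (hS : IsResolventAt A ν S) (y : E) :
    R y - S y = (ν - μ) • R (S y) := by
  obtain ⟨h, e⟩ := hS.right_inv y
  have h1 := hR.left_inv ⟨S y, h⟩
  have h2 : μ • S y - A ⟨S y, h⟩ = y - (ν - μ) • S y := by
    have : μ • S y - A ⟨S y, h⟩ = (ν • S y - A ⟨S y, h⟩) - (ν - μ) • S y := by module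
    rw [this, e]
  rw [h2, map_sub, map_smul] at h1
  change R y - (ν - μ) • R (S y) = S y at h1
  rw [sub_eq_iff_eq_add.1 h1, add_sub_cancel_left]

end Basics

/-! ### The resolvent as a Laplace transform -/

section Laplace

variable {E : Type*} [NormedAddCommGroup E] [NormedSpace ℂ E]

/-- The kernel `t ^ k * exp (-μ t)` of the (derivatives of the) Laplace transform. -/
noncomputable def lapKernel (k : ℕ) (μ : ℂ) (t : ℝ) : ℂ := (t : ℂ) ^ k * Complex.exp (-μ * t)

/-- The integral `∫₀^∞ t ^ k * exp (-μ t) T(t) x dt`. -/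
noncomputable def laplace (T : ℝ → E →L[ℂ] E) (k : ℕ) (μ : ℂ) (x : E) : E :=
  ∫ t in Ioi (0 : ℝ), lapKernel k μ t • T t x

theorem norm_lapKernel (k : ℕ) (μ : ℂ) {t : ℝ} (ht : 0 ≤ t) :
    ‖lapKernel k μ t‖ = t ^ k * Real.exp (-μ.re * t) := by
  simp [lapKernel, Complex.norm_exp, abs_of_nonneg ht]

theorem continuous_lapKernel (k : ℕ) (μ : ℂ) : Continuous (lapKernel k μ) := by
  unfold lapKernel; fun_prop

theorem integrableOn_pow_mul_exp (k : ℕ) {γ : ℝ} (hγ : 0 < γ) :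
    IntegrableOn (fun t : ℝ => t ^ k * Real.exp (-γ * t)) (Ioi 0) := by
  have := integrableOn_rpow_mul_exp_neg_mul_rpow (p := 1) (s := (k : ℝ)) (b := γ)
    (by have : (0 : ℝ) ≤ k := k.cast_nonneg
        linarith) one_pos hγ
  simpa using this

theorem integrableOn_lapKernel (k : ℕ) {μ : ℂ} (hμ : 0 < μ.re) :
    IntegrableOn (lapKernel k μ) (Ioi 0) := by
  refine (integrableOn_pow_mul_exp k hμ).mono'
    (continuous_lapKernel k μ).aestronglyMeasurable ?_
  filter_upwards [ae_restrict_mem measurableSet_Ioi] with t ht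
  exact (norm_lapKernel k μ (le_of_lt ht)).le

theorem tendsto_lapKernel (k : ℕ) {μ : ℂ} (hμ : 0 < μ.re) :
    Tendsto (lapKernel k μ) atTop (𝓝 0) := by
  rw [tendsto_zero_iff_norm_tendsto_zero]
  refine (tendsto_rpow_mul_exp_neg_mul_atTop_nhds_zero k μ.re hμ).congr' ?_
  filter_upwards [eventually_ge_atTop 0] with t ht
  rw [norm_lapKernel k μ ht, Real.rpow_natCast]

theorem hasDerivAt_lapKernel_zero (μ : ℂ) (t : ℝ) :
    HasDerivAt (lapKernel 0 μ) (-μ * lapKernel 0 μ t) t := by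
  have h : HasDerivAt (fun z : ℂ => z ^ 0 * Complex.exp (-μ * z))
      (-μ * ((t : ℂ) ^ 0 * Complex.exp (-μ * t))) (t : ℂ) := by
    have := ((hasDerivAt_id (t : ℂ)).const_mul (-μ)).cexp
    simpa [mul_comm] using this
  exact h.comp_ofReal

theorem hasDerivAt_lapKernel_succ (k : ℕ) (μ : ℂ) (t : ℝ) :
    HasDerivAt (lapKernel (k + 1) μ) ((k + 1) * lapKernel k μ t - μ * lapKernel (k + 1) μ t) t := by
  have h : HasDerivAt (fun z : ℂ => z ^ (k + 1) * Complex.exp (-μ * z))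
      ((k + 1) * ((t : ℂ) ^ k * Complex.exp (-μ * t))
        - μ * ((t : ℂ) ^ (k + 1) * Complex.exp (-μ * t))) (t : ℂ) := by
    have := (hasDerivAt_pow (k + 1) (t : ℂ)).mul (((hasDerivAt_id (t : ℂ)).const_mul (-μ)).cexp)
    refine this.congr_deriv ?_
    simp; ring
  exact h.comp_ofReal

theorem IsSG.aestronglyMeasurable {M : ℝ} {T : ℝ → E →L[ℂ] E} (hT : IsSG M 0 T) (x : E) :
    AEStronglyMeasurable (fun t => T t x) (volume.restrict (Ioi 0)) :=
  ((hT.continuousOn x).mono Ioi_subset_Ici_self).aestronglyMeasurable measurableSet_Ioi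

theorem IsSG.integrableOn_smul {M : ℝ} {T : ℝ → E →L[ℂ] E} (hT : IsSG M 0 T) (x : E)
    {φ : ℝ → ℂ} (hφ : IntegrableOn φ (Ioi 0)) :
    IntegrableOn (fun t => φ t • T t x) (Ioi 0) := by
  refine (hφ.norm.mul_const (M * ‖x‖)).mono'
    (hφ.aestronglyMeasurable.smul (hT.aestronglyMeasurable x)) ?_
  filter_upwards [ae_restrict_mem measurableSet_Ioi] with t ht
  rw [norm_smul]
  exact mul_le_mul_of_nonneg_left (hT.norm_apply_le (le_of_lt ht) x) (norm_nonneg _)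

theorem IsSG.integrableOn_laplace {M : ℝ} {T : ℝ → E →L[ℂ] E} (hT : IsSG M 0 T) (x : E)
    (k : ℕ) {μ : ℂ} (hμ : 0 < μ.re) :
    IntegrableOn (fun t => lapKernel k μ t • T t x) (Ioi 0) :=
  hT.integrableOn_smul x (integrableOn_lapKernel k hμ)

theorem IsSG.norm_laplace_zero_le {M : ℝ} {T : ℝ → E →L[ℂ] E} (hT : IsSG M 0 T) (x : E)
    {μ : ℂ} (hμ : 0 < μ.re) : ‖laplace T 0 μ x‖ ≤ M / μ.re * ‖x‖ := by
  have h1 : ∫ t in Ioi (0 : ℝ), Real.exp (-μ.re * t) * (M * ‖x‖) = M / μ.re * ‖x‖ := by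
    rw [integral_mul_const, integral_exp_mul_Ioi (by linarith)]
    simp; ring
  rw [← h1]
  refine norm_integral_le_of_norm_le ?_ ?_
  · simpa [IntegrableOn] using (integrableOn_pow_mul_exp 0 hμ).mul_const (M * ‖x‖)
  · filter_upwards [ae_restrict_mem measurableSet_Ioi] with t ht
    rw [norm_smul, norm_lapKernel 0 μ (le_of_lt ht), pow_zero, one_mul]
    exact mul_le_mul_of_nonneg_left (hT.norm_apply_le (le_of_lt ht) x) (Real.exp_pos _).le

variable [CompleteSpace E]

/-- Integration by parts against a general scalar kernel; the kernels `t^k e^(-μt)` then give the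
resolvent and all its powers. -/
theorem IsSG.integral_deriv_smul {M : ℝ} {T : ℝ → E →L[ℂ] E} (hT : IsSG M 0 T)
    (x : (generator T).domain) {φ φ' : ℝ → ℂ} (hφ : ∀ t, HasDerivAt φ (φ' t) t)
    (hi : IntegrableOn φ (Ioi 0)) (hi' : IntegrableOn φ' (Ioi 0)) (h0 : Tendsto φ atTop (𝓝 0)) :
    (∫ t in Ioi (0 : ℝ), φ t • T t (generator T x)) +
      ∫ t in Ioi (0 : ℝ), φ' t • T t (x : E) = -φ 0 • (x : E) := by
  rw [← integral_add (hT.integrableOn_smul _ hi) (hT.integrableOn_smul _ hi')]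
  rw [integral_Ioi_of_hasDerivAt_of_tendsto (f := fun t => φ t • T t (x : E)) (m := 0)]
  · simp [hT.isC0Semigroup.map_zero]
  · exact ((hφ 0).continuousAt.continuousWithinAt).smul (hT.continuousOn (x : E) 0 self_mem_Ici)
  · intro t ht
    exact (hφ t).smul (hT.hasDerivAt x ht)
  · exact (hT.integrableOn_smul _ hi).add (hT.integrableOn_smul _ hi')
  · rw [tendsto_zero_iff_norm_tendsto_zero]
    have h1 : Tendsto (fun t => ‖φ t‖ * (M * ‖(x : E)‖)) atTop (𝓝 0) := by
      simpa using h0.norm.mul_const (M * ‖(x : E)‖)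
    refine tendsto_of_tendsto_of_tendsto_of_le_of_le' tendsto_const_nhds h1
      (Eventually.of_forall fun _ => norm_nonneg _) ?_
    filter_upwards [eventually_ge_atTop 0] with t ht
    rw [norm_smul]
    exact mul_le_mul_of_nonneg_left (hT.norm_apply_le ht _) (norm_nonneg _)

theorem IsSG.laplace_zero_apply {M : ℝ} {T : ℝ → E →L[ℂ] E} (hT : IsSG M 0 T)
    (x : (generator T).domain) {μ : ℂ} (hμ : 0 < μ.re) :
    laplace T 0 μ (μ • (x : E) - generator T x) = x := by
  have h := hT.integral_deriv_smul x (hasDerivAt_lapKernel_zero μ) (integrableOn_lapKernel 0 hμ)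
    ((integrableOn_lapKernel 0 hμ).const_mul _) (tendsto_lapKernel 0 hμ)
  have e : laplace T 0 μ (μ • (x : E) - generator T x) =
      -((∫ t in Ioi (0 : ℝ), lapKernel 0 μ t • T t (generator T x)) +
      ∫ t in Ioi (0 : ℝ), (-μ * lapKernel 0 μ t) • T t (x : E)) := by
    rw [← integral_add (hT.integrableOn_laplace _ 0 hμ)
      (hT.integrableOn_smul _ ((integrableOn_lapKernel 0 hμ).const_mul _)), ← integral_neg, laplace]
    congr 1; ext t
    rw [map_sub, map_smul]
    module
  rw [e, h]
  simp [lapKernel]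

theorem IsSG.laplace_succ_apply {M : ℝ} {T : ℝ → E →L[ℂ] E} (hT : IsSG M 0 T)
    (x : (generator T).domain) (k : ℕ) {μ : ℂ} (hμ : 0 < μ.re) :
    laplace T (k + 1) μ (μ • (x : E) - generator T x) = ((k : ℂ) + 1) • laplace T k μ x := by
  have hi' : IntegrableOn (fun t => (k + 1) * lapKernel k μ t - μ * lapKernel (k + 1) μ t)
      (Ioi 0) :=
    ((integrableOn_lapKernel k hμ).const_mul _).sub ((integrableOn_lapKernel (k + 1) hμ).const_mul _)
  have h := hT.integral_deriv_smul x (hasDerivAt_lapKernel_succ k μ)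
    (integrableOn_lapKernel (k + 1) hμ) hi' (tendsto_lapKernel (k + 1) hμ)
  have hs : IntegrableOn (fun t => ((k : ℂ) + 1) • lapKernel k μ t • T t (x : E)) (Ioi 0) :=
    (hT.integrableOn_laplace (x : E) k hμ).smul ((k : ℂ) + 1)
  rw [laplace, laplace, ← integral_smul, ← sub_eq_zero,
    ← integral_sub (hT.integrableOn_laplace _ _ hμ) hs]
  rw [← integral_add (hT.integrableOn_laplace _ (k + 1) hμ) (hT.integrableOn_smul _ hi')] at h
  rw [← neg_eq_zero, ← integral_neg]
  convert h using 1
  · congr 1; ext t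
    rw [map_sub, map_smul]
    module
  · simp [lapKernel]

/-- Shifting the integration variable turns `T(h)` on the Laplace integral into `e^(μh)` times the
integral over `(h, ∞)`, which can be differentiated in `h` for arbitrary `x`. -/
theorem IsSG.laplace_zero_mem {M : ℝ} {T : ℝ → E →L[ℂ] E} (hT : IsSG M 0 T)
    (x : E) {μ : ℂ} (hμ : 0 < μ.re) :
    Tendsto (diffQuot T (laplace T 0 μ x)) (𝓝[>] 0) (𝓝 (μ • laplace T 0 μ x - x)) := by
  set J := laplace T 0 μ x
  have hint := hT.integrableOn_laplace x 0 hμ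
  set g : ℝ → E := fun t => lapKernel 0 μ t • T t x
  have hg0 : ContinuousWithinAt g (Ici 0) 0 :=
    (continuous_lapKernel 0 μ).continuousWithinAt.smul (hT.continuousOn x 0 self_mem_Ici)
  have hTJ : ∀ h : ℝ, 0 < h → T h J = Complex.exp (μ * h) • (J - ∫ t in (0 : ℝ)..h, g t) := by
    intro h hh
    have h1 : J - ∫ t in (0 : ℝ)..h, g t = ∫ t in Ioi h, g t := by
      rw [intervalIntegral.integral_of_le hh.le, sub_eq_iff_eq_add', ← setIntegral_union
        (Ioc_disjoint_Ioi le_rfl) measurableSet_Ioi (hint.mono_set Ioc_subset_Ioi_self)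
        (hint.mono_set (Ioi_subset_Ioi hh.le)), Ioc_union_Ioi_eq_Ioi hh.le]
      rfl
    have h2 : ∫ t in Ioi h, g t = ∫ t in Ioi (0 : ℝ), g (t + h) := by
      have := (measurePreserving_add_right volume h).setIntegral_preimage_emb
        (measurableEmbedding_addRight h) g (Ioi h)
      simpa using this.symm
    rw [h1, h2, ← integral_smul]
    change T h (∫ t in Ioi (0 : ℝ), g t) = _
    rw [← ContinuousLinearMap.integral_comp_comm _ hint]
    refine setIntegral_congr_fun measurableSet_Ioi fun t ht => ?_
    simp only [g, map_smul, lapKernel, pow_zero, one_mul, smul_smul]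
    rw [← Complex.exp_add, add_comm t h, hT.isC0Semigroup.map_add_apply hh.le (le_of_lt ht)]
    congr 2
    push_cast; ring
  have hd : HasDerivWithinAt (fun h : ℝ => Complex.exp (μ * h) • (J - ∫ t in (0 : ℝ)..h, g t))
      (μ • J - x) (Ioi 0) 0 := by
    have h1 : HasDerivWithinAt (fun h : ℝ => ∫ t in (0 : ℝ)..h, g t) (g 0) (Ioi 0) 0 := by
      have : HasDerivWithinAt (fun h : ℝ => ∫ t in (0 : ℝ)..h, g t) (g 0) (Ici 0) 0 := by
        refine intervalIntegral.integral_hasDerivWithinAt_right (t := Ioi 0) (by simp) ?_ ?_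
        · exact ⟨Ioi 0, self_mem_nhdsWithin, hint.aestronglyMeasurable⟩
        · exact hg0.mono Ioi_subset_Ici_self
      exact this.mono Ioi_subset_Ici_self
    have h2 : HasDerivAt (fun h : ℝ => Complex.exp (μ * h)) μ 0 := by
      have := (((hasDerivAt_id ((0 : ℝ) : ℂ)).const_mul μ).cexp).comp_ofReal
      simpa using this
    have h3 := h2.hasDerivWithinAt.smul (h1.const_sub J) (s := Ioi 0)
    refine h3.congr_deriv ?_
    simp [g, lapKernel, hT.isC0Semigroup.map_zero, add_comm, sub_eq_add_neg]
  rw [hasDerivWithinAt_iff_tendsto_slope] at hd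
  simp only [mem_Ioi, lt_irrefl, not_false_eq_true, sdiff_singleton_eq_self] at hd
  refine hd.congr' ?_
  filter_upwards [self_mem_nhdsWithin] with h hh
  rw [diffQuot, hTJ h hh, slope_def_module, ← Complex.ofReal_inv, Complex.coe_smul]
  simp

/-- The resolvent at a point of the open right half-plane is the Laplace transform. -/
theorem IsSG.exists_isResolventAt {M : ℝ} {T : ℝ → E →L[ℂ] E} (hT : IsSG M 0 T)
    {μ : ℂ} (hμ : 0 < μ.re) :
    ∃ R : E →L[ℂ] E, IsResolventAt (generator T) μ R ∧ (∀ x, R x = laplace T 0 μ x) ∧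
      ‖R‖ ≤ M / μ.re := by
  let f : E →ₗ[ℂ] E :=
    { toFun := laplace T 0 μ
      map_add' := fun x y => by
        simp only [laplace, map_add, smul_add]
        exact integral_add (hT.integrableOn_laplace x 0 hμ) (hT.integrableOn_laplace y 0 hμ)
      map_smul' := fun c x => by
        simp only [laplace, map_smul, smul_comm _ c, integral_smul, RingHom.id_apply] }
  refine ⟨f.mkContinuous _ fun x => hT.norm_laplace_zero_le x hμ, ⟨fun y => ?_, fun x => ?_⟩,
    fun x => rfl, LinearMap.mkContinuous_norm_le _ (div_nonneg hT.nonneg hμ.le) _⟩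
  · obtain ⟨h, e⟩ := generator_eq_of_tendsto (hT.laplace_zero_mem y hμ)
    refine ⟨h, ?_⟩
    change μ • laplace T 0 μ y - generator T ⟨laplace T 0 μ y, h⟩ = y
    rw [e]; abel
  · exact hT.laplace_zero_apply x hμ

theorem IsSG.isResolventAt {M : ℝ} {T : ℝ → E →L[ℂ] E} (hT : IsSG M 0 T)
    {μ : ℂ} (hμ : 0 < μ.re) : IsResolventAt (generator T) μ (resolvent (generator T) μ) := by
  obtain ⟨R, hR, -⟩ := hT.exists_isResolventAt hμ
  rwa [hR.resolvent_eq]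

theorem IsSG.resolvent_apply {M : ℝ} {T : ℝ → E →L[ℂ] E} (hT : IsSG M 0 T)
    {μ : ℂ} (hμ : 0 < μ.re) (x : E) : resolvent (generator T) μ x = laplace T 0 μ x := by
  obtain ⟨R, hR, h, -⟩ := hT.exists_isResolventAt hμ
  rw [hR.resolvent_eq, h]

theorem IsSG.norm_resolvent_le {M : ℝ} {T : ℝ → E →L[ℂ] E} (hT : IsSG M 0 T)
    {μ : ℂ} (hμ : 0 < μ.re) : ‖resolvent (generator T) μ‖ ≤ M / μ.re := by
  obtain ⟨R, hR, -, h⟩ := hT.exists_isResolventAt hμ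
  rwa [hR.resolvent_eq]

/-- Iterated, this gives `k! R(μ)^(k+1)` as the Laplace transform of `t^k T(t)`, without
differentiating the resolvent in `μ`. -/
theorem IsSG.laplace_succ {M : ℝ} {T : ℝ → E →L[ℂ] E} (hT : IsSG M 0 T)
    (k : ℕ) {μ : ℂ} (hμ : 0 < μ.re) (x : E) :
    laplace T (k + 1) μ x = ((k : ℂ) + 1) • laplace T k μ (resolvent (generator T) μ x) := by
  obtain ⟨h, e⟩ := (hT.isResolventAt hμ).right_inv x
  rw [← hT.laplace_succ_apply ⟨_, h⟩ k hμ, e]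

theorem IsSG.isClosed_generator {M : ℝ} {T : ℝ → E →L[ℂ] E} (hT : IsSG M 0 T) :
    (generator T).IsClosed :=
  (hT.isResolventAt (μ := 1) (by simp)).isClosed

end Laplace

/-! ### Resolvent bounds in half-planes and sectors -/

section Sectorial

variable {E : Type*} [NormedAddCommGroup E] [NormedSpace ℂ E]

/-- Neumann series perturbation of the resolvent. -/
theorem IsResolventAt.exists_of_near [CompleteSpace E] {A : E →ₗ.[ℂ] E} {μ ν : ℂ} {R : E →L[ℂ] E}
    (hR : IsResolventAt A μ R) {c : ℝ} (hc : ‖R‖ ≤ c) (h : ‖ν - μ‖ * c ≤ 1 / 2) :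
    ∃ S : E →L[ℂ] E, IsResolventAt A ν S ∧ ‖S‖ ≤ 2 * c := by
  set P : E →L[ℂ] E := (μ - ν) • R
  have hP : ‖P‖ ≤ 1 / 2 := by
    rw [norm_smul, norm_sub_rev]
    exact (mul_le_mul_of_nonneg_left hc (norm_nonneg _)).trans h
  let u := Units.oneSub P (by linarith)
  have hu : ∀ y, u.val y = y - (μ - ν) • R y := fun y => rfl
  set V : E →L[ℂ] E := ↑u⁻¹
  have huV : ∀ y, V y - (μ - ν) • R (V y) = y := fun y => by
    rw [← hu]
    exact congrArg (fun f : E →L[ℂ] E => f y) u.mul_inv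
  have hVu : ∀ y, V (y - (μ - ν) • R y) = y := fun y => by
    rw [← hu]
    exact congrArg (fun f : E →L[ℂ] E => f y) u.inv_mul
  refine ⟨R.comp V, ⟨fun y => ?_, fun x => ?_⟩, ?_⟩
  · obtain ⟨hy, e⟩ := hR.right_inv (V y)
    refine ⟨hy, ?_⟩
    change ν • R (V y) - A ⟨R (V y), hy⟩ = y
    have : ν • R (V y) - A ⟨R (V y), hy⟩ =
      (μ • R (V y) - A ⟨R (V y), hy⟩) - (μ - ν) • R (V y) := by module
    rw [this, e, huV]
  · change R (V (ν • (x : E) - A x)) = x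
    have h1 := hR.left_inv x
    have h2 : ν • (x : E) - A x = (μ • (x : E) - A x) - (μ - ν) • R (μ • (x : E) - A x) := by
      rw [h1]; module
    rw [h2, hVu, h1]
  -- The norm bound comes from this fixed-point identity: since `‖P‖ ≤ 1/2`, the last term is
  -- absorbed on the left.
  · have h1 : R.comp V = R + P.comp (R.comp V) := by
      ext y
      change R (V y) = R y + (μ - ν) • R (R (V y))
      rw [← map_smul, ← map_add]
      nth_rw 1 [sub_eq_iff_eq_add.1 (huV y)]
    have h2 : ‖R.comp V‖ ≤ c + 1 / 2 * ‖R.comp V‖ := by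
      calc ‖R.comp V‖ = ‖R + P.comp (R.comp V)‖ := by rw [← h1]
        _ ≤ ‖R‖ + ‖P‖ * ‖R.comp V‖ :=
          (norm_add_le _ _).trans (by gcongr; exact ContinuousLinearMap.opNorm_comp_le _ _)
        _ ≤ _ := by gcongr
    linarith

/-- `M / Re μ` controls the resolvent near the real axis and `C / |Im μ|` away from it; add the two
using `|μ| ≤ |Re μ| + |Im μ|`. -/
theorem resolvent_norm_le_div_norm [CompleteSpace E] {M : ℝ} {T : ℝ → E →L[ℂ] E}
    (hT : IsSG M 0 T) {C : ℝ} (hC : 0 < C)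
    (h : ∀ γ η : ℝ, 0 < γ → η ≠ 0 →
      ‖resolvent (generator T) (γ + η * Complex.I)‖ ≤ C / |η|) {μ : ℂ} (hμ : 0 < μ.re) :
    ‖resolvent (generator T) μ‖ ≤ (M + C) / ‖μ‖ := by
  have hμ0 : μ ≠ 0 := fun h => by simp [h] at hμ
  rw [le_div_iff₀ (norm_pos_iff.2 hμ0)]
  have h1 := hT.norm_resolvent_le hμ
  rw [le_div_iff₀ hμ] at h1
  have h2 : ‖resolvent (generator T) μ‖ * |μ.im| ≤ C := by
    rcases eq_or_ne μ.im 0 with h0 | h0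
    · simpa [h0] using hC.le
    · have := h μ.re μ.im hμ h0
      rwa [Complex.re_add_im, le_div_iff₀ (abs_pos.2 h0)] at this
  calc _ ≤ ‖resolvent (generator T) μ‖ * (|μ.re| + |μ.im|) := by
        gcongr; exact Complex.norm_le_abs_re_add_abs_im μ
    _ ≤ _ := by rw [abs_of_pos hμ]; linarith

theorem neg_re_le_of_abs_arg_lt {δ : ℝ} (hδ' : δ < Real.pi / 2) {μ : ℂ}
    (h : |μ.arg| < Real.pi / 2 + δ) : -μ.re ≤ Real.sin δ * ‖μ‖ := by
  have h1 : Real.cos (Real.pi / 2 + δ) < Real.cos μ.arg := by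
    rw [← Real.cos_abs μ.arg]
    exact Real.cos_lt_cos_of_nonneg_of_le_pi (abs_nonneg _) (by linarith) h
  have h2 : -Real.sin δ < Real.cos μ.arg := by
    rw [add_comm, Real.cos_add_pi_div_two] at h1
    exact h1
  have h3 := Complex.norm_mul_cos_arg μ
  nlinarith [norm_nonneg μ]

/-- Near the imaginary axis the resolvent at height `Im μ` has norm at most `C / |Im μ|`, so a
Neumann series reaches points to the left at distance proportional to `|Im μ|`: a sector. -/
theorem exists_sector_bound [CompleteSpace E] {M : ℝ} {T : ℝ → E →L[ℂ] E} (hT : IsSG M 0 T)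
    (h0 : (0 : ℂ) ∈ resolventSet (generator T)) {C : ℝ} (hC : 0 < C)
    (h : ∀ γ η : ℝ, 0 < γ → η ≠ 0 →
      ‖resolvent (generator T) (γ + η * Complex.I)‖ ≤ C / |η|) :
    ∃ δ K : ℝ, 0 < δ ∧ δ < Real.pi / 2 ∧ 1 < K ∧
        resolventSector δ ⊆ resolventSet (generator T) ∧
        ∀ μ ∈ resolventSector δ \ {0}, ‖resolvent (generator T) μ‖ ≤ K / ‖μ‖ := by
  -- `c` will be `sin δ`. The summand `2` gives `c ≤ 1/2`, hence `|μ| ≤ 2 |Im μ|` left of the axis;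
  -- the summand `8C` gives `4cC ≤ 1/2`, the Neumann condition.
  set c : ℝ := 1 / (2 + 8 * C)
  have hc : 0 < c := by positivity
  have hc2 : c ≤ 1 / 2 := one_div_le_one_div_of_le two_pos (by linarith)
  have hc8 : 8 * c * C ≤ 1 := by
    simp only [c]; rw [mul_one_div, div_mul_eq_mul_div, div_le_one (by positivity)]; linarith
  set δ := Real.arcsin c
  have hδ : 0 < δ := Real.arcsin_pos.2 hc
  have hδ' : δ < Real.pi / 2 := Real.arcsin_lt_pi_div_two.2 (by linarith)
  have hsin : Real.sin δ = c := Real.sin_arcsin (by linarith) (by linarith)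
  -- `M + C` serves the right half-plane, `4C` the points reached by perturbation, and the `2`
  -- forces `K > 1`.
  set K := M + 4 * C + 2
  have hM := hT.nonneg
  have key : ∀ μ : ℂ, μ ≠ 0 → |μ.arg| < Real.pi / 2 + δ →
      ∃ R, IsResolventAt (generator T) μ R ∧ ‖R‖ ≤ K / ‖μ‖ := by
    intro μ hμ0 hμ
    have hpos := norm_pos_iff.2 hμ0
    rcases lt_or_ge 0 μ.re with hre | hre
    · refine ⟨_, hT.isResolventAt hre, (resolvent_norm_le_div_norm hT hC h hre).trans ?_⟩
      gcongr
      simp only [K]; linarith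
    · have h1 := neg_re_le_of_abs_arg_lt hδ' hμ
      rw [hsin] at h1
      have h2 := Complex.norm_le_abs_re_add_abs_im μ
      rw [abs_of_nonpos hre] at h2
      have h3 : ‖μ‖ ≤ 2 * |μ.im| := by nlinarith
      have him : 0 < |μ.im| := by linarith
      have hg : 0 < c * ‖μ‖ := by positivity
      -- The base point is `γ + i Im μ`, level with `μ`; its distance to `μ` is at most `2c|μ| ≤ 4c
      -- |Im μ|`.
      set γ := c * ‖μ‖
      have h4 := h γ μ.im hg (abs_pos.1 him)
      have hre' : 0 < ((γ : ℂ) + μ.im * Complex.I).re := by simpa using hg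
      obtain ⟨S, hS, hS'⟩ := (hT.isResolventAt hre').exists_of_near h4 (ν := μ) (by
        have : μ - (γ + μ.im * Complex.I) = ((μ.re - γ : ℝ) : ℂ) := by
          apply Complex.ext <;> simp
        rw [this, Complex.norm_real, Real.norm_eq_abs, abs_of_nonpos (by linarith),
          ← mul_div_assoc, div_le_iff₀ him]
        have h5 : -(μ.re - γ) ≤ 4 * c * |μ.im| := by
          have : γ ≤ c * (2 * |μ.im|) := mul_le_mul_of_nonneg_left h3 hc.le
          linarith
        nlinarith)
      refine ⟨S, hS, hS'.trans ?_⟩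
      rw [← mul_div_assoc, div_le_div_iff₀ him hpos]
      simp only [K]
      nlinarith
  refine ⟨δ, K, hδ, hδ', by simp only [K]; linarith, ?_, ?_⟩
  · rintro μ (⟨hμ0, hμ⟩ | hμ)
    · obtain ⟨R, hR, -⟩ := key μ hμ0 hμ
      exact hR.mem_resolventSet
    · rw [mem_singleton_iff.1 hμ]; exact h0
  · rintro μ ⟨⟨hμ0, hμ⟩ | hμ, hne⟩
    · obtain ⟨R, hR, hR'⟩ := key μ hμ0 hμ
      rwa [hR.resolvent_eq]
    · exact absurd hμ hne

theorem halfPlane_bound_of_sector_bound {A : E →ₗ.[ℂ] E} {δ K : ℝ} (hδ : 0 < δ) (hK : 1 < K)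
    (hs : resolventSector δ ⊆ resolventSet A)
    (h : ∀ μ ∈ resolventSector δ \ {0}, ‖resolvent A μ‖ ≤ K / ‖μ‖) {γ η : ℝ} (hγ : 0 < γ)
    (hη : η ≠ 0) :
    (γ + η * Complex.I : ℂ) ∈ resolventSet A ∧ ‖resolvent A (γ + η * Complex.I)‖ ≤ K / |η| := by
  set μ : ℂ := γ + η * Complex.I
  have hre : 0 < μ.re := by simpa [μ] using hγ
  have him : μ.im = η := by simp [μ]
  have hμ0 : μ ≠ 0 := fun h => by simp [h] at hre
  have harg : |μ.arg| < Real.pi / 2 := Complex.abs_arg_lt_pi_div_two_iff.2 (Or.inl hre)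
  have hmem : μ ∈ resolventSector δ := Or.inl ⟨hμ0, by linarith⟩
  refine ⟨hs hmem, (h μ ⟨hmem, hμ0⟩).trans ?_⟩
  have := Complex.abs_im_le_norm μ
  rw [him] at this
  have hη' := abs_pos.2 hη
  gcongr

end Sectorial

/-! ### From the resolvent bound to `A T(t)` by Laplace inversion -/

section FourierInversion

variable {E : Type*} [NormedAddCommGroup E] [NormedSpace ℂ E]

/-- The vertical line `Re = γ`, in the frequency parametrization. -/
noncomputable def vline (γ ξ : ℝ) : ℂ := γ + (2 * Real.pi * ξ : ℝ) * Complex.I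

theorem vline_re (γ ξ : ℝ) : (vline γ ξ).re = γ := by simp [vline]

theorem norm_vline_sq (γ ξ : ℝ) : ‖vline γ ξ‖ ^ 2 = γ ^ 2 + (2 * Real.pi * ξ) ^ 2 := by
  rw [← Complex.normSq_eq_norm_sq, vline, Complex.normSq_add_mul_I]

theorem continuous_vline (γ : ℝ) : Continuous (vline γ) := by
  unfold vline; fun_prop

theorem inv_norm_vline_sq_eq {γ : ℝ} (hγ : 0 < γ) (ξ : ℝ) :
    (‖vline γ ξ‖ ^ 2)⁻¹ = (γ ^ 2)⁻¹ * (1 + (2 * Real.pi / γ * ξ) ^ 2)⁻¹ := by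
  rw [norm_vline_sq, ← mul_inv]
  congr 1
  field_simp

theorem integrable_inv_norm_vline_sq {γ : ℝ} (hγ : 0 < γ) :
    Integrable fun ξ => (‖vline γ ξ‖ ^ 2)⁻¹ := by
  simp_rw [inv_norm_vline_sq_eq hγ]
  exact ((integrable_inv_one_add_sq).comp_mul_left' (by positivity)).const_mul _

theorem integral_inv_norm_vline_sq {γ : ℝ} (hγ : 0 < γ) :
    ∫ ξ, (‖vline γ ξ‖ ^ 2)⁻¹ = (2 * γ)⁻¹ := by
  simp_rw [inv_norm_vline_sq_eq hγ]
  rw [integral_const_mul, Measure.integral_comp_mul_left (fun x : ℝ => (1 + x ^ 2)⁻¹),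
    integral_univ_inv_one_add_sq, abs_of_pos (by positivity), smul_eq_mul]
  have := Real.pi_pos
  field_simp

variable {M : ℝ} {T : ℝ → E →L[ℂ] E}

theorem IsSG.continuous_laplace_vline (hT : IsSG M 0 T) (k : ℕ) {γ : ℝ} (hγ : 0 < γ) (x : E) :
    Continuous fun ξ => laplace T k (vline γ ξ) x := by
  refine continuous_of_dominated (bound := fun t => t ^ k * Real.exp (-γ * t) * (M * ‖x‖)) ?_ ?_ ?_ ?_
  · exact fun ξ => (hT.integrableOn_laplace x k (by rwa [vline_re])).aestronglyMeasurable
  · intro ξ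
    filter_upwards [ae_restrict_mem measurableSet_Ioi] with t ht
    rw [norm_smul, norm_lapKernel k _ (le_of_lt ht), vline_re]
    exact mul_le_mul_of_nonneg_left (hT.norm_apply_le (le_of_lt ht) x)
      (mul_nonneg (pow_nonneg (le_of_lt ht) k) (Real.exp_pos _).le)
  · exact (integrableOn_pow_mul_exp k hγ).mul_const _
  · refine Eventually.of_forall fun t => ?_
    have := continuous_vline γ
    unfold lapKernel
    fun_prop

open scoped FourierTransform in
-- The Laplace transform on a vertical line is the Fourier transform of the damped orbit, so Fourier
-- inversion applies. The `2π` in `vline` matches the normalisation of `𝓕`.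
theorem fourier_indicator_eq_laplace (k : ℕ) (γ ξ : ℝ) (x : E) :
    𝓕 (indicator (Ioi (0 : ℝ)) fun t => lapKernel k γ t • T t x) ξ =
      laplace T k (vline γ ξ) x := by
  rw [Real.fourier_real_eq_integral_exp_smul, laplace, ← integral_indicator measurableSet_Ioi]
  congr 1; ext t
  by_cases ht : t ∈ Ioi (0 : ℝ)
  · rw [indicator_of_mem ht, indicator_of_mem ht, smul_smul]
    congr 1
    rw [lapKernel, lapKernel, mul_left_comm, ← Complex.exp_add]
    congr 2
    simp [vline]; ring
  · rw [indicator_of_notMem ht, indicator_of_notMem ht, smul_zero]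

variable [CompleteSpace E]

open scoped FourierTransform in
/-- Inversion of the Laplace transform on a vertical line. -/
theorem IsSG.integral_exp_smul_laplace (hT : IsSG M 0 T) (k : ℕ) {γ : ℝ} (hγ : 0 < γ) (x : E)
    (hi : Integrable fun ξ => laplace T k (vline γ ξ) x) {t : ℝ} (ht : 0 < t) :
    ∫ ξ, Complex.exp (vline γ ξ * t) • laplace T k (vline γ ξ) x = (t : ℂ) ^ k • T t x := by
  have hF : 𝓕 (indicator (Ioi (0 : ℝ)) fun t => lapKernel k γ t • T t x) =
      fun ξ => laplace T k (vline γ ξ) x :=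
    funext fun ξ => fourier_indicator_eq_laplace k γ ξ x
  have hint : Integrable (indicator (Ioi (0 : ℝ)) fun t => lapKernel k γ t • T t x) :=
    (hT.integrableOn_laplace x k (by simpa using hγ)).integrable_indicator measurableSet_Ioi
  have hev : (indicator (Ioi (0 : ℝ)) fun t => lapKernel k γ t • T t x) =ᶠ[𝓝 t]
      fun t => lapKernel k γ t • T t x := by
    filter_upwards [lt_mem_nhds ht] with s hs
    exact indicator_of_mem (s := Ioi (0 : ℝ)) hs _
  have hc : ContinuousAt (indicator (Ioi (0 : ℝ)) fun t => lapKernel k γ t • T t x) t := by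
    refine ContinuousAt.congr ?_ hev.symm
    exact (continuous_lapKernel k γ).continuousAt.smul
      ((hT.continuousOn x).continuousAt (Ici_mem_nhds ht))
  have h := hint.fourierInv_fourier_eq (hF ▸ hi) hc
  rw [hF, Real.fourierInv_eq', hev.eq_of_nhds] at h
  have h2 : ∀ ξ : ℝ, Complex.exp (vline γ ξ * t) • laplace T k (vline γ ξ) x =
      Complex.exp (γ * t) • Complex.exp (↑(2 * Real.pi * inner ℝ ξ t) * Complex.I) •
        laplace T k (vline γ ξ) x := by
    intro ξ
    rw [smul_smul, ← Complex.exp_add]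
    congr 2
    simp [vline]; ring
  simp_rw [h2]
  rw [integral_smul, h, smul_smul, lapKernel, mul_left_comm, ← Complex.exp_add]
  simp

theorem IsSG.laplace_one (hT : IsSG M 0 T) {μ : ℂ} (hμ : 0 < μ.re) (x : E) :
    laplace T 1 μ x = resolvent (generator T) μ (resolvent (generator T) μ x) := by
  rw [hT.laplace_succ 0 hμ, ← hT.resolvent_apply hμ]; simp

theorem IsSG.laplace_two (hT : IsSG M 0 T) {μ : ℂ} (hμ : 0 < μ.re) (x : E) :
    laplace T 2 μ x = (2 : ℂ) • resolvent (generator T) μ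
      (resolvent (generator T) μ (resolvent (generator T) μ x)) := by
  rw [hT.laplace_succ 1 hμ, hT.laplace_one hμ]; norm_num

/-- A resolvent bound of order `1 / |μ|` in the half-plane makes `A T(t)` bounded with
norm `O(1 / t)`. -/
theorem IsSG.generator_apply_norm_le (hT : IsSG M 0 T)
    (h0 : (0 : ℂ) ∈ resolventSet (generator T)) {K : ℝ} (hK : 0 ≤ K)
    (h : ∀ μ : ℂ, 0 < μ.re → ‖resolvent (generator T) μ‖ ≤ K / ‖μ‖) {t : ℝ} (ht : 0 < t) (x : E) :
    ∃ hx : T t x ∈ (generator T).domain,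
      ‖generator T ⟨T t x, hx⟩‖ ≤ Real.exp 1 * (K ^ 3 + K ^ 2) / t * ‖x‖ := by
  -- On this line `|e^(μt)| = e`, and the integral of `|μ|^(-2)` is `t/2`; after division by `t²`
  -- the order is `1/t`.
  set γ := 1 / t with hγdef
  have hγ : 0 < γ := by positivity
  set R := resolvent (generator T)
  have hre : ∀ ξ, 0 < (vline γ ξ).re := fun ξ => by rwa [vline_re]
  have hn : ∀ ξ, 0 < ‖vline γ ξ‖ := fun ξ =>
    norm_pos_iff.2 fun h => by have := hre ξ; simp [h] at this
  have hγn : ∀ ξ, γ ≤ ‖vline γ ξ‖ := fun ξ => by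
    simpa [vline_re] using Complex.re_le_norm (vline γ ξ)
  have hR : ∀ ξ y, ‖R (vline γ ξ) y‖ ≤ K / ‖vline γ ξ‖ * ‖y‖ := fun ξ y =>
    (R (vline γ ξ)).le_of_opNorm_le (h _ (hre ξ)) y
  have hR2 : ∀ ξ, ‖R (vline γ ξ) (R (vline γ ξ) x)‖ ≤ K ^ 2 * ‖x‖ * (‖vline γ ξ‖ ^ 2)⁻¹ := by
    intro ξ
    calc _ ≤ K / ‖vline γ ξ‖ * (K / ‖vline γ ξ‖ * ‖x‖) :=
          (hR ξ _).trans (mul_le_mul_of_nonneg_left (hR ξ _) (div_nonneg hK (hn ξ).le))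
      _ = _ := by have := (hn ξ).ne'; field_simp
  have hR3 : ∀ ξ, ‖vline γ ξ‖ * ‖R (vline γ ξ) (R (vline γ ξ) (R (vline γ ξ) x))‖ ≤
      K ^ 3 * ‖x‖ * (‖vline γ ξ‖ ^ 2)⁻¹ := by
    intro ξ
    calc _ ≤ ‖vline γ ξ‖ * (K / ‖vline γ ξ‖ * (K ^ 2 * ‖x‖ * (‖vline γ ξ‖ ^ 2)⁻¹)) :=
          mul_le_mul_of_nonneg_left ((hR ξ _).trans
            (mul_le_mul_of_nonneg_left (hR2 ξ) (div_nonneg hK (hn ξ).le))) (hn ξ).le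
      _ = _ := by have := (hn ξ).ne'; field_simp
  have hbi := integrable_inv_norm_vline_sq hγ
  have hi2 : Integrable fun ξ => laplace T 2 (vline γ ξ) x := by
    refine (hbi.const_mul (2 / γ * (K ^ 3 * ‖x‖))).mono'
      (hT.continuous_laplace_vline 2 hγ x).aestronglyMeasurable (Eventually.of_forall fun ξ => ?_)
    rw [hT.laplace_two (hre ξ), norm_smul, Complex.norm_ofNat]
    have h1 : γ * ‖R (vline γ ξ) (R (vline γ ξ) (R (vline γ ξ) x))‖ ≤
      K ^ 3 * ‖x‖ * (‖vline γ ξ‖ ^ 2)⁻¹ :=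
      (mul_le_mul_of_nonneg_right (hγn ξ) (norm_nonneg _)).trans (hR3 ξ)
    rw [← le_div_iff₀' hγ] at h1
    calc _ ≤ 2 * (K ^ 3 * ‖x‖ * (‖vline γ ξ‖ ^ 2)⁻¹ / γ) := by gcongr
      _ = _ := by ring
  -- `G` is `A` applied to `2 R(μ)³ x`, written as `2 (μ R³ - R²) x`.
  set G : ℝ → E := fun ξ =>
    vline γ ξ • laplace T 2 (vline γ ξ) x - (2 : ℂ) • laplace T 1 (vline γ ξ) x
  have hGc : Continuous fun ξ => Complex.exp (vline γ ξ * t) • G ξ := by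
    have h1 := hT.continuous_laplace_vline 2 hγ x
    have h2 := hT.continuous_laplace_vline 1 hγ x
    have h3 := continuous_vline γ
    fun_prop
  have hGn : ∀ ξ, ‖Complex.exp (vline γ ξ * t) • G ξ‖ ≤
      2 * Real.exp 1 * (K ^ 3 + K ^ 2) * ‖x‖ * (‖vline γ ξ‖ ^ 2)⁻¹ := by
    intro ξ
    have he : ‖Complex.exp (vline γ ξ * t)‖ = Real.exp 1 := by
      rw [Complex.norm_exp]
      congr 1
      simp only [Complex.re_mul_ofReal, vline_re, γ]
      field_simp
    have hG : ‖G ξ‖ ≤ 2 * (K ^ 3 * ‖x‖ * (‖vline γ ξ‖ ^ 2)⁻¹) +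
        2 * (K ^ 2 * ‖x‖ * (‖vline γ ξ‖ ^ 2)⁻¹) := by
      refine (_root_.norm_sub_le _ _).trans (add_le_add ?_ ?_)
      · rw [hT.laplace_two (hre ξ), norm_smul, norm_smul, Complex.norm_ofNat, mul_left_comm]
        exact mul_le_mul_of_nonneg_left (hR3 ξ) two_pos.le
      · rw [hT.laplace_one (hre ξ), norm_smul, Complex.norm_ofNat]
        exact mul_le_mul_of_nonneg_left (hR2 ξ) two_pos.le
    rw [norm_smul, he]
    calc _ ≤ Real.exp 1 * _ := mul_le_mul_of_nonneg_left hG (Real.exp_pos _).le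
      _ = _ := by ring
  have hGi : Integrable fun ξ => Complex.exp (vline γ ξ * t) • G ξ :=
    (hbi.const_mul _).mono' hGc.aestronglyMeasurable (Eventually.of_forall hGn)
  set y : E := ((t : ℂ) ^ 2)⁻¹ • ∫ ξ, Complex.exp (vline γ ξ * t) • G ξ
  have hyn : ‖y‖ ≤ Real.exp 1 * (K ^ 3 + K ^ 2) / t * ‖x‖ := by
    have h1 := norm_integral_le_of_norm_le (hbi.const_mul _) (Eventually.of_forall hGn)
    rw [integral_const_mul, integral_inv_norm_vline_sq hγ] at h1
    rw [norm_smul, norm_inv, norm_pow, Complex.norm_real, Real.norm_eq_abs, abs_of_pos ht]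
    refine (mul_le_mul_of_nonneg_left h1 (by positivity)).trans_eq ?_
    simp only [γ]
    field_simp
  have hR0 := isResolventAt_resolvent hT.isClosed_generator h0
  change IsResolventAt _ _ (R 0) at hR0
  -- Here `0 ∈ ρ(A)` enters: `A` is not moved through the integral; instead the bounded operator
  -- `R(0) = -A⁻¹` is, and the resolvent identity between `0` and `μ` undoes `A`.
  have hRG : ∀ ξ, R 0 (G ξ) = -laplace T 2 (vline γ ξ) x := by
    intro ξ
    have h1 := hR0.sub_eq (hT.isResolventAt (hre ξ)) (R (vline γ ξ) (R (vline γ ξ) x))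
    rw [sub_zero] at h1
    simp only [G]
    rw [hT.laplace_two (hre ξ), hT.laplace_one (hre ξ), map_sub, map_smul, map_smul, map_smul,
      smul_comm, ← h1]
    module
  have hTy : T t x = R 0 (-y) := by
    rw [map_neg]
    simp only [y]
    rw [map_smul, ← ContinuousLinearMap.integral_comp_comm _ hGi]
    simp_rw [map_smul, hRG, smul_neg]
    rw [integral_neg, hT.integral_exp_smul_laplace 2 hγ x hi2 ht, smul_neg, neg_neg, smul_smul,
      inv_mul_cancel₀ (by simpa using ht.ne'), one_smul]
  obtain ⟨hm, e⟩ := hR0.right_inv (-y)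
  refine ⟨hTy ▸ hm, ?_⟩
  have e' : generator T ⟨T t x, hTy ▸ hm⟩ = y := by
    rw [zero_smul, zero_sub, neg_inj] at e
    have hs : (⟨T t x, hTy ▸ hm⟩ : (generator T).domain) = ⟨R 0 (-y), hm⟩ := Subtype.ext hTy
    rw [hs, e]
  rw [e']
  exact hyn

end FourierInversion

/-! ### Norm differentiability, the operators `A^n T(t)`, and the resolvent bound -/

section Differentiable

variable {E : Type*} [NormedAddCommGroup E] [NormedSpace ℂ E]

/-- `B t = A T(t)` is everywhere defined and bounded, for all `t > 0`. -/
def IsGeneratorComp (T B : ℝ → E →L[ℂ] E) : Prop :=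
  ∀ t : ℝ, 0 < t → ∀ x : E, ∃ hx : T t x ∈ (generator T).domain, generator T ⟨T t x, hx⟩ = B t x

variable {M L : ℝ} {T B : ℝ → E →L[ℂ] E}

theorem IsGeneratorComp.apply_add (hB : IsGeneratorComp T B) (hT : IsC0Semigroup T) {s t : ℝ}
    (hs : 0 < s) (ht : 0 ≤ t) (x : E) : B (s + t) x = B s (T t x) := by
  obtain ⟨h1, e1⟩ := hB (s + t) (by linarith) x
  obtain ⟨h2, e2⟩ := hB s hs (T t x)
  rw [← e1, ← e2]
  congr 1
  exact Subtype.ext (hT.map_add_apply hs.le ht x)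

theorem IsGeneratorComp.apply_add' (hB : IsGeneratorComp T B) (hT : IsC0Semigroup T) {s t : ℝ}
    (hs : 0 < s) (ht : 0 ≤ t) (x : E) : B (s + t) x = T t (B s x) := by
  obtain ⟨h1, e1⟩ := hB (s + t) (by linarith) x
  obtain ⟨h2, e2⟩ := hB s hs x
  obtain ⟨h3, e3⟩ := hT.generator_apply ht ⟨_, h2⟩
  rw [← e1, ← e2, ← e3]
  congr 1
  refine Subtype.ext ?_
  change T (s + t) x = T t (T s x)
  rw [add_comm, hT.map_add_apply ht hs.le]

/-- After time `t/2` every orbit has entered the domain, where orbits are differentiable. -/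
theorem IsGeneratorComp.hasDerivAt_apply (hB : IsGeneratorComp T B) (hT : IsSG M 0 T) {t : ℝ}
    (ht : 0 < t) (x : E) : HasDerivAt (fun s => T s x) (B t x) t := by
  have ha : 0 < t / 2 := by positivity
  obtain ⟨h, e⟩ := hB (t / 2) ha x
  have h1 := (hT.hasDerivAt ⟨_, h⟩ (t := t - t / 2) (by linarith)).scomp t
    ((hasDerivAt_id t).sub_const (t / 2))
  rw [e, ← hB.apply_add' hT.isC0Semigroup ha (by linarith), one_smul, add_sub_cancel] at h1
  refine h1.congr_of_eventuallyEq ?_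
  filter_upwards [lt_mem_nhds (show t / 2 < t by linarith)] with s hs
  simp only [Function.comp, id]
  rw [← hT.isC0Semigroup.map_add_apply (by linarith) ha.le, sub_add_cancel]

theorem IsGeneratorComp.norm_sub_le (hB : IsGeneratorComp T B) (hT : IsSG M 0 T) (hL : 0 < L)
    (h : ∀ t, 0 < t → ‖B t‖ ≤ L / t) {a s t : ℝ} (ha : 0 < a) (hs : a ≤ s) (ht : a ≤ t) (x : E) :
    ‖T s x - T t x‖ ≤ L / a * ‖x‖ * |s - t| := by
  refine (convex_Ici a).norm_image_sub_le_of_norm_hasDerivWithin_le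
    (f := fun s => T s x) (f' := fun s => B s x)
    (fun r hr => (hB.hasDerivAt_apply hT (ha.trans_le hr) x).hasDerivWithinAt)
    (fun r hr => ?_) ht hs
  refine (B r).le_of_opNorm_le ((h r (ha.trans_le hr)).trans ?_) x
  exact div_le_div_of_nonneg_left hL.le ha hr

/-- If `‖A T(t)‖ = O(1 / t)` then `T` is differentiable in operator norm. -/
theorem IsGeneratorComp.hasDerivAt (hB : IsGeneratorComp T B) (hT : IsSG M 0 T) (hL : 0 < L)
    (h : ∀ t, 0 < t → ‖B t‖ ≤ L / t) {t : ℝ} (ht : 0 < t) : HasDerivAt T (B t) t := by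
  -- For `s ≥ 2a` one can split off `B a` and still have time `s - a ≥ a` left, where `T` is
  -- Lipschitz with constant `L/a`.
  set a := t / 3 with ha'
  have ha : 0 < a := by positivity
  have hBlip : ∀ s, 2 * a ≤ s → ∀ x, ‖B s x - B t x‖ ≤ (L / a) ^ 2 * ‖x‖ * |s - t| := by
    intro s hs x
    have e1 : ∀ r, a ≤ r → B r x = B a (T (r - a) x) := fun r hr => by
      rw [← hB.apply_add hT.isC0Semigroup ha (by linarith)]; congr 2; ring
    rw [e1 s (by linarith), e1 t (by linarith), ← map_sub]
    refine ((B a).le_of_opNorm_le (h a ha) _).trans ?_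
    have := hB.norm_sub_le hT hL h ha (s := s - a) (t := t - a) (by linarith) (by linarith) x
    rw [sub_sub_sub_cancel_right] at this
    calc _ ≤ L / a * (L / a * ‖x‖ * |s - t|) := by gcongr
      _ = _ := by ring
  -- The Lipschitz bound on `B`, fed into the mean value inequality for `T r x - (r - t) B t x`,
  -- gives a quadratic remainder uniform in `‖x‖ ≤ 1`: this upgrades strong to norm
  -- differentiability.
  have hquad : ∀ s, 2 * a ≤ s → ‖T s - T t - (s - t) • B t‖ ≤ (L / a) ^ 2 * |s - t| ^ 2 := by
    intro s hs
    refine ContinuousLinearMap.opNorm_le_bound _ (by positivity) fun x => ?_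
    have hsub : ∀ r ∈ uIcc t s, 2 * a ≤ r ∧ |r - t| ≤ |s - t| := fun r hr => by
      refine ⟨(le_inf (by linarith) hs).trans hr.1, ?_⟩
      exact abs_sub_left_of_mem_uIcc hr
    have := (convex_uIcc t s).norm_image_sub_le_of_norm_hasDerivWithin_le
      (f := fun r => T r x - (r - t) • B t x) (f' := fun r => B r x - B t x)
      (C := (L / a) ^ 2 * ‖x‖ * |s - t|)
      (fun r hr => by
        have hd := (hB.hasDerivAt_apply hT (lt_of_lt_of_le (by linarith) (hsub r hr).1) x).sub
          (((hasDerivAt_id r).sub_const t).smul_const (B t x))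
        rw [one_smul] at hd
        exact hd.hasDerivWithinAt)
      (fun r hr => (hBlip r (hsub r hr).1 x).trans
        (mul_le_mul_of_nonneg_left (hsub r hr).2 (by positivity)))
      left_mem_uIcc right_mem_uIcc
    calc _ = ‖T s x - (s - t) • B t x - (T t x - (t - t) • B t x)‖ := by
          congr 1
          change T s x - T t x - (s - t) • B t x = _
          rw [sub_self, zero_smul]; abel
      _ ≤ _ := this
      _ = _ := by rw [Real.norm_eq_abs]; ring
  rw [hasDerivAt_iff_isLittleO]
  refine Asymptotics.IsBigO.trans_isLittleO (g := fun s => ‖s - t‖ ^ 2) ?_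
    (Asymptotics.isLittleO_pow_sub_sub t one_lt_two)
  refine Asymptotics.IsBigO.of_bound ((L / a) ^ 2) ?_
  filter_upwards [lt_mem_nhds (show 2 * a < t by linarith)] with s hs
  simpa using hquad s hs.le

/-- The derivative of a norm differentiable semigroup is `A T(t)`. -/
theorem isGeneratorComp_of_hasDerivAt (hT : IsC0Semigroup T)
    (h : ∀ t, 0 < t → HasDerivAt T (B t) t) : IsGeneratorComp T B := by
  intro t ht x
  apply generator_eq_of_tendsto
  have h1 : HasDerivAt (fun s => T s x) (B t x) t :=
    (ContinuousLinearMap.apply ℝ E x |>.comp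
      (ContinuousLinearMap.restrictScalarsL ℂ E E ℝ ℝ)).hasFDerivAt.comp_hasDerivAt t (h t ht)
  rw [hasDerivAt_iff_tendsto_slope_zero] at h1
  refine (h1.mono_left (nhdsWithin_mono 0 fun s hs => (ne_of_gt hs : s ≠ 0))).congr' ?_
  filter_upwards [self_mem_nhdsWithin] with s hs
  rw [diffQuot, ← hT.map_add_apply (le_of_lt hs) ht.le, add_comm, ← Complex.ofReal_inv,
    Complex.coe_smul]

/-- The `n`-th derivative `A ^ n T(t)`, where `B t = A T(t)`. -/
noncomputable def iterGen (T B : ℝ → E →L[ℂ] E) (n : ℕ) (t : ℝ) : E →L[ℂ] E :=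
  (B (t / (n + 1))) ^ n * T (t / (n + 1))

theorem iterGen_zero (t : ℝ) : iterGen T B 0 t = T t := by simp [iterGen]

theorem norm_iterGen_le (hT : IsSG M 0 T) (hL : 0 < L)
    (h : ∀ t, 0 < t → ‖B t‖ ≤ L / t) (n : ℕ) {t : ℝ} (ht : 0 < t) :
    ‖iterGen T B n t‖ ≤ M * ((n + 1) * L / t) ^ n := by
  have h1 : 0 < t / (n + 1) := by positivity
  have h2 := h _ h1
  rcases n with - | n
  · simpa [iterGen] using hT.norm_le ht.le
  · refine (norm_mul_le _ _).trans ?_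
    rw [mul_comm]
    refine mul_le_mul (hT.norm_le h1.le) ?_ (norm_nonneg _) hT.nonneg
    refine (norm_pow_le' _ n.succ_pos).trans (pow_le_pow_left₀ (norm_nonneg _) (h2.trans_eq ?_) _)
    field_simp

theorem IsGeneratorComp.mul_eq (hB : IsGeneratorComp T B) (hT : IsC0Semigroup T) {s t : ℝ}
    (hs : 0 < s) (ht : 0 ≤ t) : B s * T t = B (s + t) := by
  ext x; exact (hB.apply_add hT hs ht x).symm

theorem IsGeneratorComp.mul_eq' (hB : IsGeneratorComp T B) (hT : IsC0Semigroup T) {s t : ℝ}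
    (hs : 0 < s) (ht : 0 ≤ t) : T t * B s = B (s + t) := by
  ext x; exact (hB.apply_add' hT hs ht x).symm

/-- Only the total time matters: `B(s + r) = B(s) T(r)` with commuting factors, so the surplus `r`
of each of the `n` factors can be handed to the last one. -/
theorem IsGeneratorComp.pow_mul_eq (hB : IsGeneratorComp T B) (hT : IsC0Semigroup T) (n : ℕ)
    {s r u : ℝ} (hs : 0 < s) (hr : 0 ≤ r) (hu : 0 ≤ u) :
    B (s + r) ^ n * T u = B s ^ n * T (n * r + u) := by
  have hc : Commute (B s) (T r) := by
    rw [Commute, SemiconjBy, hB.mul_eq hT hs hr, hB.mul_eq' hT hs hr]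
  have hp : ∀ n : ℕ, T r ^ n = T (n * r) := by
    intro n
    induction n with
    | zero => simp [hT.map_zero]; rfl
    | succ n ih =>
      rw [pow_succ, ih]
      push_cast
      rw [add_one_mul, hT.map_add _ _ (by positivity) hr]; rfl
  rw [← hB.mul_eq hT hs hr, hc.mul_pow, hp, mul_assoc, hT.map_add _ _ (by positivity) hu]
  rfl

/-- Near `t`, keep the `n` factors at a fixed time `s` and let only the final semigroup factor carry
the variable. With `s = t/(n+2)` its derivative is exactly the next iterate. -/
theorem IsGeneratorComp.hasDerivAt_iterGen (hB : IsGeneratorComp T B) (hT : IsC0Semigroup T)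
    (h : ∀ t, 0 < t → HasDerivAt T (B t) t) (n : ℕ) {t : ℝ} (ht : 0 < t) :
    HasDerivAt (iterGen T B n) (iterGen T B (n + 1) t) t := by
  set s := t / ((n + 1 : ℕ) + 1) with hs'
  have hs : 0 < s := by positivity
  have hts : t = (n + 2) * s := by
    rw [hs']; push_cast; field_simp; ring
  have e1 : B s ^ n * B (t - n * s) = iterGen T B (n + 1) t := by
    rw [iterGen, ← hs', pow_succ, mul_assoc, hB.mul_eq hT hs hs.le]
    congr 2; rw [hts]; ring
  have hd : HasDerivAt (fun u => B s ^ n * T (u - n * s)) (B s ^ n * B (t - n * s)) t := by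
    have h1 : HasDerivAt T (B (t - n * s)) (t - n * s) :=
      h _ (by rw [hts]; nlinarith)
    have h2 := (h1.scomp t ((hasDerivAt_id t).sub_const (n * s)))
    rw [one_smul] at h2
    exact h2.const_mul (B s ^ n)
  rw [← e1]
  refine hd.congr_of_eventuallyEq ?_
  filter_upwards [lt_mem_nhds (show (n + 1) * s < t by rw [hts]; nlinarith)] with u hu
  have hn : (0 : ℝ) < n + 1 := by positivity
  have h3 : 0 ≤ u / (n + 1) - s := by
    rw [sub_nonneg, le_div_iff₀ hn]; linarith
  have := hB.pow_mul_eq hT n hs h3 (u := u / (n + 1)) (by linarith)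
  rw [add_sub_cancel] at this
  rw [iterGen, this]
  congr 2
  field_simp
  ring

theorem exists_generatorComp_of_bound
    (h : ∀ t : ℝ, 0 < t → ∀ x : E, ∃ hx : T t x ∈ (generator T).domain,
      ‖generator T ⟨T t x, hx⟩‖ ≤ L / t * ‖x‖) (hL : 0 < L) (t : ℝ) (ht : 0 < t) :
    ∃ B : E →L[ℂ] E,
      (∀ x : E, ∃ hx : T t x ∈ (generator T).domain, generator T ⟨T t x, hx⟩ = B x) ∧
      ‖B‖ ≤ L / t := by
  choose hx hb using h t ht
  let f : E →ₗ[ℂ] E := (generator T).toFun ∘ₗ (T t).toLinearMap.codRestrict _ hx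
  exact ⟨f.mkContinuous (L / t) hb, fun x => ⟨hx x, rfl⟩,
    LinearMap.mkContinuous_norm_le _ (by positivity) _⟩

theorem exists_generatorComp {L : ℝ} (h : ∀ t : ℝ, 0 < t → ∃ B : E →L[ℂ] E,
      (∀ x : E, ∃ hx : T t x ∈ (generator T).domain, generator T ⟨T t x, hx⟩ = B x) ∧
      ‖B‖ ≤ L / t) :
    ∃ B : ℝ → E →L[ℂ] E, IsGeneratorComp T B ∧ ∀ t, 0 < t → ‖B t‖ ≤ L / t := by
  choose B hB hL using h
  refine ⟨fun t => if ht : 0 < t then B t ht else 0, fun t ht => ?_, fun t ht => ?_⟩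
  · simpa [ht] using hB t ht
  · simpa [ht] using hL t ht

variable [CompleteSpace E]

/-- The estimate `‖R(μ)‖ ≤ C / |Im μ|` from `‖A T(t)‖ ≤ L / t`, by integrating the Laplace
transform by parts twice on `(1 / |Im μ|, ∞)`. -/
theorem IsGeneratorComp.norm_resolvent_le (hB : IsGeneratorComp T B) (hT : IsSG M 0 T) (hL : 0 < L)
    (h : ∀ t, 0 < t → ‖B t‖ ≤ L / t) {μ : ℂ} (hμ : 0 < μ.re) (hη : μ.im ≠ 0) :
    ‖resolvent (generator T) μ‖ ≤ (M * (2 + 2 * L + 9 * L ^ 2)) / |μ.im| := by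
  have hd : ∀ t, 0 < t → HasDerivAt T (B t) t := fun t ht => hB.hasDerivAt hT hL h ht
  -- This cut balances the pieces: trivial bound on `(0, s]`, double integration by parts beyond.
  -- Each contribution is a constant times `s`.
  set s : ℝ := 1 / |μ.im|
  have him : 0 < |μ.im| := abs_pos.2 hη
  have hs : 0 < s := by positivity
  have hM := hT.nonneg
  have hμ0 : μ ≠ 0 := fun h => by simp [h] at hμ
  have hle : |μ.im| ≤ ‖μ‖ := Complex.abs_im_le_norm μ
  have hinv : ‖μ‖⁻¹ ≤ s := by
    rw [← one_div]; exact one_div_le_one_div_of_le him hle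
  have hD : ∀ n (x : E) t, 0 < t →
      ‖iterGen T B n t x‖ ≤ M * ((n + 1) * L / t) ^ n * ‖x‖ := fun n x t ht =>
    (iterGen T B n t).le_of_opNorm_le (norm_iterGen_le hT hL h n ht) x
  have hE : ∀ t, 0 ≤ t → ‖lapKernel 0 μ t‖ ≤ 1 := fun t ht => by
    rw [norm_lapKernel 0 μ ht, pow_zero, one_mul, Real.exp_le_one_iff]
    nlinarith
  refine ContinuousLinearMap.opNorm_le_bound _ (by positivity) fun x => ?_
  rw [hT.resolvent_apply hμ]
  have hint := hT.integrableOn_laplace x 0 hμ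
  have h2i : IntegrableOn (fun t : ℝ => M * (3 * L) ^ 2 * ‖x‖ * t ^ (-2 : ℝ)) (Ioi s) :=
    (integrableOn_Ioi_rpow_of_lt (by norm_num) hs).const_mul _
  have hD2n : ∀ t, s < t → ‖lapKernel 0 μ t • iterGen T B 2 t x‖ ≤
      M * (3 * L) ^ 2 * ‖x‖ * t ^ (-2 : ℝ) := by
    intro t ht
    have ht0 := hs.trans ht
    rw [norm_smul]
    refine (mul_le_mul (hE t ht0.le) (hD 2 x t ht0) (norm_nonneg _) zero_le_one).trans_eq ?_
    rw [Real.rpow_neg ht0.le, Real.rpow_two, div_pow]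
    push_cast
    ring
  have hder : ∀ n t, 0 < t → HasDerivAt (fun t => lapKernel 0 μ t • iterGen T B n t x)
      (lapKernel 0 μ t • iterGen T B (n + 1) t x - μ • lapKernel 0 μ t • iterGen T B n t x) t := by
    intro n t ht
    have h1 : HasDerivAt (fun t => iterGen T B n t x) (iterGen T B (n + 1) t x) t :=
      (ContinuousLinearMap.apply ℝ E x |>.comp
        (ContinuousLinearMap.restrictScalarsL ℂ E E ℝ ℝ)).hasFDerivAt.comp_hasDerivAt t
        (hB.hasDerivAt_iterGen hT.isC0Semigroup hd n ht)
    refine ((hasDerivAt_lapKernel_zero μ t).smul h1).congr_deriv ?_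
    module
  have hi2 : IntegrableOn (fun t => lapKernel 0 μ t • iterGen T B 2 t x) (Ioi s) := by
    refine h2i.mono' ?_ ?_
    · refine ContinuousOn.aestronglyMeasurable (fun t ht => ?_) measurableSet_Ioi
      exact (hder 2 t (hs.trans ht)).continuousAt.continuousWithinAt
    · filter_upwards [ae_restrict_mem measurableSet_Ioi] with t ht
      exact hD2n t ht
  have hi2n : ‖∫ t in Ioi s, lapKernel 0 μ t • iterGen T B 2 t x‖ ≤
      9 * M * L ^ 2 * |μ.im| * ‖x‖ := by
    refine (norm_integral_le_of_norm_le h2i ?_).trans_eq ?_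
    · filter_upwards [ae_restrict_mem measurableSet_Ioi] with t ht
      exact hD2n t ht
    · rw [integral_const_mul, integral_Ioi_rpow_of_lt (by norm_num) hs]
      norm_num [Real.rpow_neg_one, s]
      ring
  -- Up to sign, the boundary terms of both integrations by parts, collected so that one use of the
  -- fundamental theorem suffices.
  set F : ℝ → E := fun t => μ⁻¹ • (lapKernel 0 μ t • iterGen T B 0 t x) +
    (μ⁻¹ ^ 2) • (lapKernel 0 μ t • iterGen T B 1 t x)
  have hFd : ∀ t ∈ Ici s, HasDerivAt F ((μ⁻¹ ^ 2) • (lapKernel 0 μ t • iterGen T B 2 t x) -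
      lapKernel 0 μ t • T t x) t := by
    intro t ht
    have ht0 := hs.trans_le ht
    refine (((hder 0 t ht0).const_smul μ⁻¹).add ((hder 1 t ht0).const_smul (μ⁻¹ ^ 2))).congr_deriv ?_
    rw [smul_sub, smul_sub, smul_smul μ⁻¹ μ, inv_mul_cancel₀ hμ0, smul_smul (μ⁻¹ ^ 2) μ, pow_two,
      mul_assoc, inv_mul_cancel₀ hμ0, iterGen_zero]
    module
  have hF0 : Tendsto F atTop (𝓝 0) := by
    have hterm : ∀ n, n ≤ 1 →
        Tendsto (fun t => lapKernel 0 μ t • iterGen T B n t x) atTop (𝓝 0) := by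
      intro n _
      rw [tendsto_zero_iff_norm_tendsto_zero]
      have h1 : Tendsto (fun t => ‖lapKernel 0 μ t‖ * (M * ((n + 1) * L / s) ^ n * ‖x‖))
          atTop (𝓝 0) := by
        simpa using (tendsto_lapKernel 0 hμ).norm.mul_const (M * ((n + 1) * L / s) ^ n * ‖x‖)
      refine tendsto_of_tendsto_of_tendsto_of_le_of_le' tendsto_const_nhds h1
        (Eventually.of_forall fun _ => norm_nonneg _) ?_
      filter_upwards [eventually_ge_atTop s] with t ht
      rw [norm_smul]
      have ht0 := hs.trans_le ht
      refine mul_le_mul_of_nonneg_left ((hD n x t ht0).trans ?_) (norm_nonneg _)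
      gcongr
    simpa using ((hterm 0 zero_le_one).const_smul μ⁻¹).add ((hterm 1 le_rfl).const_smul (μ⁻¹ ^ 2))
  have hi1 : IntegrableOn (fun t => lapKernel 0 μ t • T t x) (Ioi s) :=
    hint.mono_set (Ioi_subset_Ioi hs.le)
  have hi2' : IntegrableOn (fun t => (μ⁻¹ ^ 2) • (lapKernel 0 μ t • iterGen T B 2 t x)) (Ioi s) :=
    hi2.smul (μ⁻¹ ^ 2)
  have hftc := integral_Ioi_of_hasDerivAt_of_tendsto' hFd (hi2'.sub hi1) hF0
  rw [integral_sub hi2' hi1, integral_smul, zero_sub] at hftc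
  have hsplit : laplace T 0 μ x = (∫ t in Ioc 0 s, lapKernel 0 μ t • T t x) +
      ((μ⁻¹ ^ 2) • (∫ t in Ioi s, lapKernel 0 μ t • iterGen T B 2 t x) + F s) := by
    rw [laplace, ← Ioc_union_Ioi_eq_Ioi hs.le, setIntegral_union (Ioc_disjoint_Ioi le_rfl)
      measurableSet_Ioi (hint.mono_set Ioc_subset_Ioi_self) hi1]
    congr 1
    rw [← neg_neg (F s), ← hftc]; abel
  have hb1 : ‖∫ t in Ioc 0 s, lapKernel 0 μ t • T t x‖ ≤ M * s * ‖x‖ := by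
    have := norm_setIntegral_le_of_norm_le_const (μ := volume) (s := Ioc 0 s)
      (f := fun t => lapKernel 0 μ t • T t x) (C := M * ‖x‖) (by simp) (fun t ht => by
        rw [norm_smul]
        exact (mul_le_mul (hE t ht.1.le) (hT.norm_apply_le ht.1.le x) (norm_nonneg _)
          zero_le_one).trans_eq (one_mul _))
    refine this.trans_eq ?_
    simp [Measure.real, hs.le]; ring
  have hb2 : ‖(μ⁻¹ ^ 2) • (∫ t in Ioi s, lapKernel 0 μ t • iterGen T B 2 t x)‖ ≤
      9 * M * L ^ 2 * s * ‖x‖ := by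
    rw [norm_smul, norm_pow, norm_inv]
    calc _ ≤ s ^ 2 * (9 * M * L ^ 2 * |μ.im| * ‖x‖) := by gcongr
      _ = _ := by simp only [s]; field_simp
  have hb3 : ‖F s‖ ≤ M * s * ‖x‖ + 2 * M * L * s * ‖x‖ := by
    refine (norm_add_le _ _).trans (add_le_add ?_ ?_)
    · rw [norm_smul, norm_inv, norm_smul]
      have h1 := hD 0 x s hs
      rw [pow_zero, mul_one] at h1
      calc _ ≤ s * (1 * (M * ‖x‖)) := by gcongr; exact hE s hs.le
        _ = _ := by ring
    · rw [norm_smul, norm_pow, norm_inv, norm_smul]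
      have h1 := hD 1 x s hs
      calc _ ≤ s ^ 2 * (1 * (M * (((1 : ℕ) + 1) * L / s) ^ 1 * ‖x‖)) := by
            gcongr; exact hE s hs.le
        _ = _ := by push_cast; field_simp; ring
  rw [hsplit]
  calc _ ≤ M * s * ‖x‖ + (9 * M * L ^ 2 * s * ‖x‖ + (M * s * ‖x‖ + 2 * M * L * s * ‖x‖)) :=
        (norm_add_le _ _).trans (add_le_add hb1 ((norm_add_le _ _).trans (add_le_add hb2 hb3)))
    _ = _ := by simp only [s]; ring

end Differentiable

/-! ### Geometry of sectors and the identity theorem -/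

section Sectors

theorem arg_eq_arctan {z : ℂ} (hz : 0 < z.re) : z.arg = Real.arctan (z.im / z.re) := by
  have h := Complex.abs_arg_lt_pi_div_two_iff.2 (Or.inl hz)
  rw [← Complex.tan_arg, Real.arctan_tan (abs_lt.1 h).1 (abs_lt.1 h).2]

/-- Parametrising the aperture by its tangent removes `arg`: openness, convexity and stability under
addition become inequalities in the real and imaginary parts. -/
theorem mem_sector_arctan {q : ℝ} {z : ℂ} :
    z ∈ sector (Real.arctan q) ↔ 0 < z.re ∧ |z.im| < q * z.re := by
  refine and_congr_right fun hz => ?_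
  rw [arg_eq_arctan hz, abs_lt, ← Real.arctan_neg, Real.arctan_lt_arctan_iff,
    Real.arctan_lt_arctan_iff, ← abs_lt, abs_div, abs_of_pos hz, div_lt_iff₀ hz]

theorem mem_closedSector_arctan {q : ℝ} {z : ℂ} :
    z ∈ closedSector (Real.arctan q) ↔ 0 < z.re ∧ |z.im| ≤ q * z.re := by
  refine and_congr_right fun hz => ?_
  rw [arg_eq_arctan hz, abs_le, ← Real.arctan_neg, Real.arctan_le_arctan_iff,
    Real.arctan_le_arctan_iff, ← abs_le, abs_div, abs_of_pos hz, div_le_iff₀ hz]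

theorem isOpen_sector_arctan (q : ℝ) : IsOpen (sector (Real.arctan q)) := by
  have h : sector (Real.arctan q) = {z : ℂ | 0 < z.re} ∩ {z : ℂ | |z.im| < q * z.re} :=
    Set.ext fun z => mem_sector_arctan
  rw [h]
  exact (isOpen_lt continuous_const Complex.continuous_re).inter
    (isOpen_lt Complex.continuous_im.abs (continuous_const.mul Complex.continuous_re))

theorem add_mem_sector_arctan {q : ℝ} {z w : ℂ} (hz : z ∈ sector (Real.arctan q))
    (hw : w ∈ sector (Real.arctan q)) : z + w ∈ sector (Real.arctan q) := by
  rw [mem_sector_arctan] at *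
  rw [Complex.add_re, Complex.add_im]
  exact ⟨add_pos hz.1 hw.1, (abs_add_le _ _).trans_lt (by linarith [hz.2, hw.2])⟩

theorem convex_sector_arctan (q : ℝ) : Convex ℝ (sector (Real.arctan q)) := by
  refine convex_iff_forall_pos.2 fun z hz w hw a b ha hb _ => add_mem_sector_arctan ?_ ?_
  all_goals
    rw [mem_sector_arctan] at *
    rw [Complex.smul_re, Complex.smul_im, smul_eq_mul, smul_eq_mul, abs_mul]
  · rw [abs_of_pos ha]
    exact ⟨mul_pos ha hz.1, by nlinarith [hz.2]⟩
  · rw [abs_of_pos hb]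
    exact ⟨mul_pos hb hw.1, by nlinarith [hw.2]⟩

theorem ofReal_mem_sector_arctan {q : ℝ} (hq : 0 < q) {t : ℝ} (ht : 0 < t) :
    (t : ℂ) ∈ sector (Real.arctan q) := by
  rw [mem_sector_arctan]; simp [ht, hq]

/-- Holomorphic functions on a sector that agree on the positive half-line are equal. -/
theorem eqOn_sector_of_eq_ofReal {F : Type*} [NormedAddCommGroup F] [NormedSpace ℂ F]
    {q : ℝ} (hq : 0 < q) {f g : ℂ → F} (hf : AnalyticOnNhd ℂ f (sector (Real.arctan q)))
    (hg : AnalyticOnNhd ℂ g (sector (Real.arctan q))) (h : ∀ t : ℝ, 0 < t → f t = g t) :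
    EqOn f g (sector (Real.arctan q)) := by
  refine hf.eqOn_of_preconnected_of_frequently_eq hg (convex_sector_arctan q).isPreconnected
    (ofReal_mem_sector_arctan hq one_pos) ?_
  have ht : Tendsto (fun t : ℝ => (t : ℂ)) (𝓝[≠] 1) (𝓝[≠] ((1 : ℝ) : ℂ)) := by
    refine tendsto_nhdsWithin_iff.2
      ⟨(Complex.continuous_ofReal.tendsto 1).mono_left nhdsWithin_le_nhds, ?_⟩
    filter_upwards [self_mem_nhdsWithin] with t ht
    simpa using ht
  refine ht.frequently (Eventually.frequently ?_)
  filter_upwards [nhdsWithin_le_nhds (lt_mem_nhds one_pos)] with t ht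
  exact h t ht

end Sectors

/-! ### The analytic extension by Taylor series -/

section Extension

variable {E : Type*} [NormedAddCommGroup E] [NormedSpace ℂ E]

/-- The `n`-th term of the Taylor expansion of the semigroup at `a`. -/
noncomputable def taylorTerm (T B : ℝ → E →L[ℂ] E) (a : ℝ) (n : ℕ) (z : ℂ) : E →L[ℂ] E :=
  (((n.factorial : ℂ))⁻¹ * (z - a) ^ n) • iterGen T B n a

open Classical in
/-- The analytic extension, by the Taylor series with centre `Re z`. -/
noncomputable def taylorExt (T B : ℝ → E →L[ℂ] E) (z : ℂ) : E →L[ℂ] E :=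
  if 0 < z.re then ∑' n, taylorTerm T B z.re n z else ContinuousLinearMap.id ℂ E

variable {M L : ℝ} {T B : ℝ → E →L[ℂ] E}

/-- The aperture (its tangent) of the sector of analyticity. -/
noncomputable def aperture (L : ℝ) : ℝ := 1 / (2 * Real.exp 1 * L)

theorem aperture_pos (hL : 0 < L) : 0 < aperture L := by
  unfold aperture; positivity

/-- A single term of the exponential series is at most its sum; this replaces Stirling's formula. -/
theorem natCast_pow_le_factorial_mul_exp (n k : ℕ) :
    (k : ℝ) ^ n ≤ n.factorial * Real.exp 1 ^ k := by
  have := Real.pow_div_factorial_le_exp (k : ℝ) k.cast_nonneg n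
  rw [div_le_iff₀ (by positivity)] at this
  rwa [← Real.exp_nat_mul, mul_one, mul_comm]

/-- `aperture` is chosen so that the geometric ratio `aperture L * L * e` is `1/2`; the extra factor
`e` comes from `n + 1` in place of `n` in the iterates. -/
theorem norm_taylorTerm_le (hT : IsSG M 0 T) (hL : 0 < L)
    (h : ∀ t, 0 < t → ‖B t‖ ≤ L / t) {a : ℝ} (ha : 0 < a) {z : ℂ}
    (hz : ‖z - a‖ ≤ aperture L * a) (n : ℕ) :
    ‖taylorTerm T B a n z‖ ≤ M * Real.exp 1 * (1 / 2) ^ n := by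
  have h1 := norm_iterGen_le hT hL h n ha
  have h2 := natCast_pow_le_factorial_mul_exp n (n + 1)
  have hM := hT.nonneg
  rw [taylorTerm, norm_smul, norm_mul, norm_inv, norm_pow, Complex.norm_natCast]
  calc _ ≤ ((n.factorial : ℝ)⁻¹ * (aperture L * a) ^ n) * (M * ((n + 1) * L / a) ^ n) := by
        have := aperture_pos hL
        gcongr
    _ = M * (aperture L * L) ^ n * ((n.factorial : ℝ)⁻¹ * ((n + 1 : ℕ) : ℝ) ^ n) := by
        push_cast
        rw [div_pow, mul_pow, mul_pow, mul_pow]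
        field_simp
    _ ≤ M * (aperture L * L) ^ n *
        ((n.factorial : ℝ)⁻¹ * (n.factorial * Real.exp 1 ^ (n + 1))) := by
        have := aperture_pos hL
        gcongr
    _ = M * Real.exp 1 * (aperture L * L * Real.exp 1) ^ n := by
        rw [inv_mul_cancel_left₀ (by positivity), pow_succ, mul_pow _ (Real.exp 1)]; ring
    _ = _ := by
        congr 2
        unfold aperture
        field_simp

theorem summable_bound (M : ℝ) : Summable fun n : ℕ => M * Real.exp 1 * (1 / 2 : ℝ) ^ n :=
  summable_geometric_two.mul_left _

/-- Differentiating in the centre telescopes: moving the power cancels the derivative of the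
preceding iterate, and only the top term survives. -/
theorem hasDerivAt_sum_taylorTerm (hB : IsGeneratorComp T B) (hT : IsC0Semigroup T)
    (h : ∀ t, 0 < t → HasDerivAt T (B t) t) (z : ℂ) (N : ℕ) {a : ℝ} (ha : 0 < a) :
    HasDerivAt (fun s => ∑ n ∈ Finset.range (N + 1), taylorTerm T B s n z)
      ((((N.factorial : ℂ))⁻¹ * (z - a) ^ N) • iterGen T B (N + 1) a) a := by
  have hlin : HasDerivAt (fun s : ℝ => z - (s : ℂ)) (-1) a :=
    (Complex.ofRealCLM.hasDerivAt).const_sub z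
  induction N with
  | zero =>
    simpa [taylorTerm] using hB.hasDerivAt_iterGen hT h 0 ha
  | succ N ih =>
    simp_rw [Finset.sum_range_succ _ (N + 1)]
    have h1 := ((hlin.pow (N + 1)).const_mul (((N + 1).factorial : ℂ))⁻¹).smul
      (hB.hasDerivAt_iterGen hT h (N + 1) ha)
    refine (ih.add h1).congr_deriv ?_
    have hf : (((N + 1).factorial : ℂ))⁻¹ * (((N + 1 : ℕ) : ℂ) * (z - a) ^ (N + 1 - 1) * -1) =
        -((N.factorial : ℂ)⁻¹ * (z - a) ^ N) := by
      have h2 : (N.factorial : ℂ) ≠ 0 := by exact_mod_cast N.factorial_ne_zero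
      have h3 : ((N : ℂ) + 1) ≠ 0 := by exact_mod_cast N.succ_ne_zero
      rw [Nat.factorial_succ, Nat.add_sub_cancel]
      push_cast
      field_simp
    rw [hf, Pi.pow_apply]
    module

theorem norm_taylor_deriv_le (hT : IsSG M 0 T) (hL : 0 < L)
    (h : ∀ t, 0 < t → ‖B t‖ ≤ L / t) {a : ℝ} (ha : 0 < a) {z : ℂ}
    (hz : ‖z - a‖ ≤ aperture L * a) (N : ℕ) :
    ‖(((N.factorial : ℂ))⁻¹ * (z - a) ^ N) • iterGen T B (N + 1) a‖ ≤
      M * Real.exp 1 ^ 2 * L / a * ((N + 1) * (1 / 2) ^ N) := by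
  have h1 := norm_iterGen_le hT hL h (N + 1) ha
  have h2 := natCast_pow_le_factorial_mul_exp (N + 1) (N + 2)
  have hM := hT.nonneg
  have hf : ((N + 1).factorial : ℝ) = (N + 1) * N.factorial := by
    rw [Nat.factorial_succ]; push_cast; ring
  rw [norm_smul, norm_mul, norm_inv, norm_pow, Complex.norm_natCast]
  calc _ ≤ ((N.factorial : ℝ)⁻¹ * (aperture L * a) ^ N) *
        (M * (((N + 1 : ℕ) + 1) * L / a) ^ (N + 1)) := by
        have := aperture_pos hL
        gcongr
    _ = M * (aperture L * L) ^ N * (L / a) *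
        ((N.factorial : ℝ)⁻¹ * ((N + 2 : ℕ) : ℝ) ^ (N + 1)) := by
        have : ((N + 1 : ℕ) : ℝ) + 1 = ((N + 2 : ℕ) : ℝ) := by push_cast; ring
        rw [this, div_pow, mul_pow, mul_pow, mul_pow, pow_succ a, pow_succ L]
        field_simp
    _ ≤ M * (aperture L * L) ^ N * (L / a) *
        ((N.factorial : ℝ)⁻¹ * ((N + 1).factorial * Real.exp 1 ^ (N + 2))) := by
        have := aperture_pos hL
        gcongr
    _ = M * Real.exp 1 ^ 2 * L / a * ((N + 1) * (aperture L * L * Real.exp 1) ^ N) := by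
        rw [hf, mul_comm ((N : ℝ) + 1), mul_assoc (N.factorial : ℝ),
          inv_mul_cancel_left₀ (by positivity), pow_add, mul_pow _ (Real.exp 1)]
        ring
    _ = _ := by
        congr 3
        unfold aperture
        field_simp

theorem norm_taylorExt_le (hT : IsSG M 0 T) (hL : 0 < L)
    (h : ∀ t, 0 < t → ‖B t‖ ≤ L / t) {z : ℂ} (hz : z ∈ sector (Real.arctan (aperture L))) :
    ‖taylorExt T B z‖ ≤ M * Real.exp 1 * 2 := by
  rw [mem_sector_arctan] at hz
  rw [taylorExt, if_pos hz.1]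
  refine tsum_of_norm_bounded (hasSum_geometric_two.mul_left (M * Real.exp 1))
    (norm_taylorTerm_le hT hL h hz.1 ?_)
  have : z - z.re = z.im * Complex.I := by
    apply Complex.ext <;> simp
  rw [this]
  simpa using hz.2.le

theorem taylorExt_ofReal (hT : IsC0Semigroup T) {t : ℝ} (ht : 0 ≤ t) :
    taylorExt T B (t : ℂ) = T t := by
  -- At `0` the fallback branch of `taylorExt` gives the identity, which is `T 0`; for `t > 0` the
  -- centre is `t` itself and only the zeroth term remains.
  rcases ht.eq_or_lt with rfl | ht
  · simp [taylorExt, hT.map_zero]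
  · rw [taylorExt, if_pos (by simpa using ht), tsum_eq_single 0]
    · simp [taylorTerm, iterGen_zero]
    · intro n hn
      simp [taylorTerm, hn]

variable [CompleteSpace E]

/-- The sum of the Taylor series does not depend on the centre. -/
theorem tsum_taylorTerm_eq (hB : IsGeneratorComp T B) (hT : IsSG M 0 T) (hL : 0 < L)
    (h : ∀ t, 0 < t → ‖B t‖ ≤ L / t) {a b : ℝ} (ha : 0 < a) (hb : 0 < b) {z : ℂ}
    (hza : ‖z - a‖ ≤ aperture L * a) (hzb : ‖z - b‖ ≤ aperture L * b) :
    ∑' n, taylorTerm T B a n z = ∑' n, taylorTerm T B b n z := by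
  have hd : ∀ t, 0 < t → HasDerivAt T (B t) t := fun t ht => hB.hasDerivAt hT hL h ht
  -- The admissible centres for `z` form a convex set, so the estimates hold on the whole segment
  -- from `a` to `b`.
  have hconv : Convex ℝ {s : ℝ | ‖z - s‖ - aperture L * s ≤ 0} := by
    have h1 : ConvexOn ℝ univ fun s : ℝ => ‖z - s‖ - aperture L * s := by
      refine ConvexOn.sub ?_ ?_
      · refine ⟨convex_univ, fun x _ y _ c d hc hd hcd => ?_⟩
        have e : z - ((c • x + d • y : ℝ) : ℂ) = c • (z - x) + d • (z - y) := by
          have : ((c : ℂ) + d) = 1 := by exact_mod_cast hcd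
          simp only [smul_eq_mul, Complex.ofReal_add, Complex.ofReal_mul, Complex.real_smul]
          linear_combination -z * this
        simp only [e]
        refine (norm_add_le _ _).trans ?_
        rw [norm_smul, norm_smul, Real.norm_of_nonneg hc, Real.norm_of_nonneg hd]
        rfl
      · exact (LinearMap.mul ℝ ℝ (aperture L)).concaveOn convex_univ
    simpa using h1.convex_le 0
  set m := min a b
  have hm : 0 < m := lt_min ha hb
  have hseg : ∀ s ∈ uIcc a b, m ≤ s ∧ ‖z - s‖ ≤ aperture L * s := by
    intro s hs
    refine ⟨hs.1, ?_⟩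
    rw [← segment_eq_uIcc] at hs
    have := hconv.segment_subset (x := a) (y := b) (by simpa using hza) (by simpa using hzb) hs
    simpa using this
  -- By the telescoped derivative, moving the centre changes a partial sum by `O((N + 1) 2^(-N))`.
  have hbound : ∀ N, ‖(∑ n ∈ Finset.range (N + 1), taylorTerm T B b n z) -
      ∑ n ∈ Finset.range (N + 1), taylorTerm T B a n z‖ ≤
      M * Real.exp 1 ^ 2 * L / m * ((N + 1) * (1 / 2) ^ N) * ‖b - a‖ := by
    intro N
    refine (convex_uIcc a b).norm_image_sub_le_of_norm_hasDerivWithin_le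
      (f := fun s => ∑ n ∈ Finset.range (N + 1), taylorTerm T B s n z)
      (fun s hs => (hasDerivAt_sum_taylorTerm hB hT.isC0Semigroup hd z N
        (hm.trans_le (hseg s hs).1)).hasDerivWithinAt) (fun s hs => ?_)
      left_mem_uIcc right_mem_uIcc
    obtain ⟨h1, h2⟩ := hseg s hs
    refine (norm_taylor_deriv_le hT hL h (hm.trans_le h1) h2 N).trans ?_
    have hM := hT.nonneg
    gcongr
  have hlim : Tendsto (fun N : ℕ => M * Real.exp 1 ^ 2 * L / m * ((N + 1) * (1 / 2) ^ N) * ‖b - a‖)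
      atTop (𝓝 0) := by
    have h1 : Tendsto (fun N : ℕ => ((N : ℝ) + 1) * (1 / 2) ^ N) atTop (𝓝 0) := by
      have h2 := tendsto_self_mul_const_pow_of_lt_one (r := (1 / 2 : ℝ)) (by norm_num) (by norm_num)
      have h3 := tendsto_pow_atTop_nhds_zero_of_lt_one (r := (1 / 2 : ℝ)) (by norm_num)
        (by norm_num)
      simpa [add_mul] using h2.add h3
    simpa only [mul_zero, zero_mul] using
      (h1.const_mul (M * Real.exp 1 ^ 2 * L / m)).mul_const ‖b - a‖
  have hsum : ∀ c : ℝ, 0 < c → ‖z - c‖ ≤ aperture L * c →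
      Tendsto (fun N => ∑ n ∈ Finset.range (N + 1), taylorTerm T B c n z) atTop
        (𝓝 (∑' n, taylorTerm T B c n z)) := fun c hc hz =>
    ((Summable.of_norm_bounded (summable_bound M)
      (norm_taylorTerm_le hT hL h hc hz)).hasSum.tendsto_sum_nat).comp (tendsto_add_atTop_nat 1)
  have h0 := squeeze_zero_norm hbound hlim
  have h1 := (hsum b hb hzb).sub (hsum a ha hza)
  exact (sub_eq_zero.1 (tendsto_nhds_unique h1 h0)).symm

theorem taylorExt_eq (hB : IsGeneratorComp T B) (hT : IsSG M 0 T) (hL : 0 < L)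
    (h : ∀ t, 0 < t → ‖B t‖ ≤ L / t) {a : ℝ} (ha : 0 < a) {z : ℂ}
    (hza : ‖z - a‖ ≤ aperture L * a) (hz : z ∈ sector (Real.arctan (aperture L))) :
    taylorExt T B z = ∑' n, taylorTerm T B a n z := by
  rw [mem_sector_arctan] at hz
  rw [taylorExt, if_pos hz.1]
  refine tsum_taylorTerm_eq hB hT hL h hz.1 ha ?_ hza
  have : z - z.re = z.im * Complex.I := by
    apply Complex.ext <;> simp
  rw [this]
  simpa using hz.2.le

/-- The centre `Re z` in the definition is not holomorphic in `z`; independence of the centre lets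
it be frozen locally, leaving a uniformly convergent series of polynomials. -/
theorem analyticOnNhd_taylorExt (hB : IsGeneratorComp T B) (hT : IsSG M 0 T) (hL : 0 < L)
    (h : ∀ t, 0 < t → ‖B t‖ ≤ L / t) :
    AnalyticOnNhd ℂ (taylorExt T B) (sector (Real.arctan (aperture L))) := by
  intro z hz
  have hz' := mem_sector_arctan.1 hz
  set a := z.re
  have hU : IsOpen (Metric.ball (a : ℂ) (aperture L * a)) := Metric.isOpen_ball
  have hzU : z ∈ Metric.ball (a : ℂ) (aperture L * a) := by
    have : z - a = z.im * Complex.I := by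
      apply Complex.ext <;> simp [a]
    rw [mem_ball_iff_norm, this]
    simpa using hz'.2
  have hd : DifferentiableOn ℂ (fun w => ∑' n, taylorTerm T B a n w)
      (Metric.ball (a : ℂ) (aperture L * a)) := by
    refine Complex.differentiableOn_tsum_of_summable_norm (summable_bound M) (fun n => ?_) hU
      (fun n w hw => norm_taylorTerm_le hT hL h hz'.1 (mem_ball_iff_norm.1 hw).le n)
    unfold taylorTerm
    fun_prop
  refine (hd.analyticAt (hU.mem_nhds hzU)).congr ?_
  filter_upwards [hU.mem_nhds hzU, (isOpen_sector_arctan _).mem_nhds hz] with w hw hw'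
  exact (taylorExt_eq hB hT hL h hz'.1 (mem_ball_iff_norm.1 hw).le hw').symm

/-- The law holds for positive reals. The identity theorem frees one summand while the other stays
real, and a second application frees the other. -/
theorem taylorExt_add (hB : IsGeneratorComp T B) (hT : IsSG M 0 T) (hL : 0 < L)
    (h : ∀ t, 0 < t → ‖B t‖ ≤ L / t) {z w : ℂ} (hz : z ∈ sector (Real.arctan (aperture L)))
    (hw : w ∈ sector (Real.arctan (aperture L))) :
    taylorExt T B (z + w) = taylorExt T B z * taylorExt T B w := by
  have hq := aperture_pos hL
  have hopen := isOpen_sector_arctan (aperture L)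
  have han := analyticOnNhd_taylorExt hB hT hL h
  have hd := han.differentiableOn
  have hmul : ∀ t s : ℝ, 0 < t → 0 < s → taylorExt T B ((t : ℂ) + s) =
      taylorExt T B t * taylorExt T B s := by
    intro t s ht hs
    rw [← Complex.ofReal_add, taylorExt_ofReal hT.isC0Semigroup (by linarith),
      taylorExt_ofReal hT.isC0Semigroup ht.le, taylorExt_ofReal hT.isC0Semigroup hs.le,
      hT.isC0Semigroup.map_add t s ht.le hs.le]
    rfl
  have hshift : ∀ c ∈ sector (Real.arctan (aperture L)),
      DifferentiableOn ℂ (fun u => taylorExt T B (u + c)) (sector (Real.arctan (aperture L))) :=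
    fun c hc => hd.comp (differentiableOn_id.add_const c) fun u hu => add_mem_sector_arctan hu hc
  have step : ∀ s : ℝ, 0 < s → ∀ z ∈ sector (Real.arctan (aperture L)),
      taylorExt T B (z + s) = taylorExt T B z * taylorExt T B s := fun s hs =>
    eqOn_sector_of_eq_ofReal hq
      ((hshift s (ofReal_mem_sector_arctan hq hs)).analyticOnNhd hopen)
      ((hd.mul_const (taylorExt T B s)).analyticOnNhd hopen) fun t ht => hmul t s ht hs
  have step2 := eqOn_sector_of_eq_ofReal hq
      ((hshift z hz).analyticOnNhd hopen)
      ((hd.const_mul (taylorExt T B z)).analyticOnNhd hopen) (fun t ht => by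
        rw [add_comm]; exact step t ht z hz) hw
  rw [add_comm]
  exact step2

/-- Replace `x` by `T s x` with small `s > 0`: there the extension is evaluated at `z + s`, near an
interior point of the sector, so it is continuous as `z → 0`. The uniform norm bound controls the
error. -/
theorem tendsto_taylorExt (hB : IsGeneratorComp T B) (hT : IsSG M 0 T) (hL : 0 < L)
    (h : ∀ t, 0 < t → ‖B t‖ ≤ L / t) (x : E) :
    Tendsto (fun z => taylorExt T B z x) (𝓝[sector (Real.arctan (aperture L))] 0) (𝓝 x) := by
  have hq := aperture_pos hL
  have hM := hT.nonneg
  set K := M * Real.exp 1 * 2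
  have hK : 0 ≤ K := by positivity
  rw [Metric.tendsto_nhds]
  intro ε hε
  have hη : 0 < ε / (2 * (K + 1)) := by positivity
  obtain ⟨s, hs, hsx⟩ : ∃ s : ℝ, 0 < s ∧ ‖x - T s x‖ < ε / (2 * (K + 1)) := by
    have := (Metric.tendsto_nhds.1 (hT.isC0Semigroup.tendsto_zero x) _ hη).and self_mem_nhdsWithin
    obtain ⟨s, h1, h2⟩ := this.exists
    exact ⟨s, h2, by rwa [dist_comm, dist_eq_norm] at h1⟩
  have hc : Tendsto (fun z : ℂ => taylorExt T B (z + s) x)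
      (𝓝[sector (Real.arctan (aperture L))] 0) (𝓝 (T s x)) := by
    have h1 := (analyticOnNhd_taylorExt hB hT hL h _
      (ofReal_mem_sector_arctan hq hs)).continuousAt
    have h2 : ContinuousAt (fun z : ℂ => taylorExt T B (z + s) x) 0 := by
      have h3 : ContinuousAt (fun z : ℂ => taylorExt T B (z + s)) 0 :=
        ContinuousAt.comp (g := taylorExt T B) (f := fun z : ℂ => z + s) (x := 0)
          (by simpa using h1) (by fun_prop)
      exact h3.clm_apply continuousAt_const
    have h4 := h2.tendsto.mono_left (nhdsWithin_le_nhds (s := sector (Real.arctan (aperture L))))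
    rwa [zero_add, taylorExt_ofReal hT.isC0Semigroup hs.le] at h4
  filter_upwards [Metric.tendsto_nhds.1 hc (ε / 2) (by positivity), self_mem_nhdsWithin]
    with z hz hzs
  rw [dist_eq_norm, taylorExt_add hB hT hL h hzs (ofReal_mem_sector_arctan hq hs),
    taylorExt_ofReal hT.isC0Semigroup hs.le] at hz
  have h5 : ‖taylorExt T B z (x - T s x)‖ ≤ K * ‖x - T s x‖ :=
    (taylorExt T B z).le_of_opNorm_le (norm_taylorExt_le hT hL h hzs) _
  have e : taylorExt T B z x - x = taylorExt T B z (x - T s x) +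
      ((taylorExt T B z * T s) x - T s x) - (x - T s x) := by
    rw [map_sub]
    change _ = _ + (taylorExt T B z (T s x) - T s x) - _
    abel
  rw [dist_eq_norm, e]
  calc _ ≤ K * ‖x - T s x‖ + ‖(taylorExt T B z * T s) x - T s x‖ + ‖x - T s x‖ :=
        (norm_sub_le _ _).trans (add_le_add_left ((norm_add_le _ _).trans
          (add_le_add_left h5 _)) _)
    _ = (K + 1) * ‖x - T s x‖ + ‖(taylorExt T B z * T s) x - T s x‖ := by ring
    _ < (K + 1) * (ε / (2 * (K + 1))) + ε / 2 := by gcongr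
    _ = ε := by field_simp; ring

theorem isAnalyticSemigroup_taylorExt (hB : IsGeneratorComp T B) (hT : IsSG M 0 T) (hL : 0 < L)
    (h : ∀ t, 0 < t → ‖B t‖ ≤ L / t) :
    IsAnalyticSemigroup (sector (Real.arctan (aperture L))) (taylorExt T B) where
  map_zero := by simp [taylorExt]
  map_add _ hz _ hw := taylorExt_add hB hT hL h hz hw
  tendsto_zero := tendsto_taylorExt hB hT hL h
  analytic := analyticOnNhd_taylorExt hB hT hL h

end Extension

/-! ### Cauchy's estimate in a subsector -/

section Cauchy

variable {E : Type*} [NormedAddCommGroup E] [NormedSpace ℂ E]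

/-- Cauchy's estimate for the derivative of a bounded analytic semigroup. -/
theorem IsAnalyticSemigroup.exists_deriv_bound {T : ℝ → E →L[ℂ] E} {S : ℂ → E →L[ℂ] E} {δ δ' C : ℝ}
    (hS : IsAnalyticSemigroup (sector δ) S) (hST : ∀ t : ℝ, 0 ≤ t → S t = T t)
    (hδ' : 0 < δ') (hδ : δ' < δ) (hδpi : δ' < Real.pi / 2)
    (hC : ∀ z ∈ closedSector δ', ‖S z‖ ≤ C) :
    ∃ L : ℝ, 0 < L ∧ ∀ t : ℝ, 0 < t → HasDerivAt T (deriv S t) t ∧ ‖deriv S t‖ ≤ L / t := by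
  set q := Real.tan δ'
  have hq : 0 < q := Real.tan_pos_of_pos_of_lt_pi_div_two hδ' hδpi
  have hqδ : Real.arctan q = δ' := Real.arctan_tan (by linarith) hδpi
  -- The solution of `c = q (1 - c)`: points of the disc have `|Im z| ≤ c t` and `Re z ≥ (1 - c) t`,
  -- so the disc lies in the closed sector of tangent `q`.
  set c := q / (1 + q)
  have hc : 0 < c := by positivity
  have hc1 : c = q * (1 - c) := by simp only [c]; field_simp; ring
  have hc2 : c < 1 := by simp only [c]; rw [div_lt_one (by positivity)]; linarith
  have hball : ∀ t : ℝ, 0 < t → ∀ z ∈ Metric.closedBall (t : ℂ) (c * t), z ∈ closedSector δ' := by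
    intro t ht z hz
    rw [mem_closedBall_iff_norm] at hz
    have hre := (Complex.abs_re_le_norm _).trans hz
    have him := (Complex.abs_im_le_norm _).trans hz
    simp only [Complex.sub_re, Complex.ofReal_re, Complex.sub_im, Complex.ofReal_im,
      sub_zero] at hre him
    have h1 : (1 - c) * t ≤ z.re := by linarith [(abs_le.1 hre).1]
    rw [← hqδ, mem_closedSector_arctan]
    refine ⟨lt_of_lt_of_le (mul_pos (by linarith) ht) h1, him.trans ?_⟩
    calc c * t = q * ((1 - c) * t) := by rw [← mul_assoc, ← hc1]
      _ ≤ _ := by gcongr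
  have hsub : closedSector δ' ⊆ sector δ := fun z hz => ⟨hz.1, hz.2.trans_lt hδ⟩
  refine ⟨(|C| + 1) / c, by positivity, fun t ht => ⟨?_, ?_⟩⟩
  · have hmem := hsub (hball t ht t (Metric.mem_closedBall_self (by positivity)))
    have h1 := (hS.analytic _ hmem).differentiableAt.hasDerivAt
    have h2 := h1.scomp t (Complex.ofRealCLM.hasDerivAt (x := t))
    rw [Complex.ofRealCLM_apply, Complex.ofReal_one, one_smul] at h2
    refine h2.congr_of_eventuallyEq ?_
    filter_upwards [lt_mem_nhds ht] with s hs
    exact (hST s hs.le).symm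
  · have h1 : DiffContOnCl ℂ S (Metric.ball (t : ℂ) (c * t)) :=
      (hS.analytic.differentiableOn).diffContOnCl_ball fun z hz => hsub (hball t ht z hz)
    have h2 := Complex.norm_deriv_le_of_forall_mem_sphere_norm_le (by positivity) h1
      (fun z hz => hC z (hball t ht z (Metric.sphere_subset_closedBall hz)))
    rw [div_div]
    refine h2.trans ?_
    gcongr
    linarith [le_abs_self C]

end Cauchy

end SemigroupTheory

/-! ### The equivalence -/

theorem mainTheorem8 {E : Type*} [NormedAddCommGroup E] [NormedSpace ℂ E] [CompleteSpace E]
    (M : ℝ) (hM : 1 ≤ M) (T : ℝ → E →L[ℂ] E) (hT : SemigroupTheory.IsSG M 0 T)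
    (h0 : (0 : ℂ) ∈ SemigroupTheory.resolventSet (SemigroupTheory.generator T)) :
    List.TFAE [
      -- extension to an analytic semigroup that is bounded on closed subsectors
      ∃ δ : ℝ, 0 < δ ∧ ∃ S : ℂ → E →L[ℂ] E,
        SemigroupTheory.IsAnalyticSemigroup (SemigroupTheory.sector δ) S ∧
        (∀ t : ℝ, 0 ≤ t → S (t : ℂ) = T t) ∧
        ∀ δ' : ℝ, 0 < δ' → δ' < δ →
          ∃ C : ℝ, ∀ z ∈ SemigroupTheory.closedSector δ', ‖S z‖ ≤ C,
      -- resolvent estimate on the right half-plane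
      ∃ C : ℝ, 0 < C ∧ ∀ γ η : ℝ, 0 < γ → η ≠ 0 →
        (γ + η * Complex.I : ℂ) ∈ SemigroupTheory.resolventSet (SemigroupTheory.generator T) ∧
        ‖SemigroupTheory.resolvent (SemigroupTheory.generator T) (γ + η * Complex.I)‖ ≤ C / |η|,
      -- resolvent estimate on a larger sector
      ∃ δ K : ℝ, 0 < δ ∧ δ < Real.pi / 2 ∧ 1 < K ∧
        SemigroupTheory.resolventSector δ ⊆
          SemigroupTheory.resolventSet (SemigroupTheory.generator T) ∧
        ∀ μ ∈ SemigroupTheory.resolventSector δ \ {0},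
          ‖SemigroupTheory.resolvent (SemigroupTheory.generator T) μ‖ ≤ K / ‖μ‖,
      -- norm differentiability, and `A T(t)` is bounded with norm at most `L / t`
      DifferentiableOn ℝ T (Set.Ioi 0) ∧
        ∃ L : ℝ, 0 < L ∧ ∀ t : ℝ, 0 < t →
          ∃ B : E →L[ℂ] E,
            (∀ x : E, ∃ hx : T t x ∈ (SemigroupTheory.generator T).domain,
              SemigroupTheory.generator T ⟨T t x, hx⟩ = B x) ∧
            ‖B‖ ≤ L / t] := by
  open SemigroupTheory in
  tfae_have 1 → 4 := by
    rintro ⟨δ, hδ, S, hS, hST, hbd⟩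
    have hpi := Real.pi_pos
    -- `δ` may exceed `π/2`, whereas the subsector is handled through `tan δ'`.
    obtain ⟨δ', hδ', hlt⟩ := exists_between (lt_min hδ (half_pos hpi))
    obtain ⟨h1, h2⟩ := lt_min_iff.1 hlt
    obtain ⟨C, hC⟩ := hbd δ' hδ' h1
    obtain ⟨L, hL, h⟩ := hS.exists_deriv_bound hST hδ' h1 h2 hC
    have hB := isGeneratorComp_of_hasDerivAt hT.isC0Semigroup fun t ht => (h t ht).1
    exact ⟨fun t ht => (h t ht).1.differentiableAt.differentiableWithinAt, L, hL,
      fun t ht => ⟨_, hB t ht, (h t ht).2⟩⟩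
  open SemigroupTheory in
  tfae_have 4 → 1 := by
    rintro ⟨-, L, hL, h⟩
    obtain ⟨B, hB, hBL⟩ := exists_generatorComp h
    -- The extension is bounded on the whole open sector, so one constant serves every `δ'`.
    refine ⟨_, Real.arctan_pos.2 (aperture_pos hL), _,
      isAnalyticSemigroup_taylorExt hB hT hL hBL,
      fun t ht => taylorExt_ofReal hT.isC0Semigroup ht, fun δ' _ hδ' =>
      ⟨_, fun z hz => norm_taylorExt_le hT hL hBL ⟨hz.1, hz.2.trans_lt hδ'⟩⟩⟩
  open SemigroupTheory in
  tfae_have 4 → 2 := by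
    rintro ⟨-, L, hL, h⟩
    obtain ⟨B, hB, hBL⟩ := exists_generatorComp h
    refine ⟨M * (2 + 2 * L + 9 * L ^ 2), by positivity, fun γ η hγ hη => ?_⟩
    have hre : 0 < ((γ : ℂ) + η * Complex.I).re := by simpa using hγ
    have him : ((γ : ℂ) + η * Complex.I).im = η := by simp
    refine ⟨(hT.isResolventAt hre).mem_resolventSet, ?_⟩
    have := hB.norm_resolvent_le hT hL hBL hre (by rwa [him])
    rwa [him] at this
  open SemigroupTheory in
  tfae_have 2 → 3 := by
    rintro ⟨C, hC, h⟩
    exact exists_sector_bound hT h0 hC fun γ η hγ hη => (h γ η hγ hη).2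
  open SemigroupTheory in
  tfae_have 3 → 2 := by
    rintro ⟨δ, K, hδ, -, hK, hs, h⟩
    exact ⟨K, by linarith, fun γ η hγ hη => halfPlane_bound_of_sector_bound hδ hK hs h hγ hη⟩
  open SemigroupTheory in
  tfae_have 2 → 4 := by
    rintro ⟨C, hC, h⟩
    have hK : 0 < M + C := by linarith
    have hbd := fun t (ht : 0 < t) x => hT.generator_apply_norm_le h0 hK.le
      (fun μ hμ => resolvent_norm_le_div_norm hT hC (fun γ η hγ hη => (h γ η hγ hη).2) hμ) ht x
    have hL : 0 < Real.exp 1 * ((M + C) ^ 3 + (M + C) ^ 2) := by positivity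
    have hex := exists_generatorComp_of_bound hbd hL
    obtain ⟨B, hB, hBL⟩ := exists_generatorComp hex
    exact ⟨fun t ht => (hB.hasDerivAt hT hL hBL ht).differentiableAt.differentiableWithinAt,
      _, hL, hex⟩
  tfae_finish
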